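/- Let $k$ be an algebraically closed field of characteristic $p>0$ and let $G\subseteq GL_n$ be a closed subgroup scheme over $k$, with Lie algebra $\mathfrak g\subseteq\mathfrak{gl}_n$. Let $\mathcal N_p(\mathfrak g)=\{x\in\mathfrak g : x^p=0\}$ and, for $x\in\mathfrak{gl}_n$ with $x^p=0$, let $\exp_x:\mathbb G_a\to GL_n$ be the morphism $\exp_x(s)=\sum_{j=0}^{p-1}(sx)^j/j!$. Assume that $G$ is of exponential type: for every $x\in\mathcal N_p(\mathfrak g)$ the morphism $\exp_x$ factors through $G$. Let $r\ge 1$. For an affine group scheme $H$ over $k$ let $H_{(r)}$ denote its $r$-th Frobenius kernel (for $H = G$, the kernel on $G$ of the $r$-th iterate $(g_{ij})\mapsto(g_{ij}^{p^r})$ of the Frobenius morphism of $GL_n$), let $Dist(H)$ be its distribution algebra, and for a homomorphism $\phi$ of affine group schemes let $d\phi$ be the induced homomorphism of distribution algebras. For $0\le j<r$ let $u_j\in Dist(\mathbb G_{a(r)})$ be the linear form on $k[\mathbb G_{a(r)}]=k[t]/(t^{p^r})$ with $u_j(t^i)=\delta_{i,p^j}$ for $0\le i<p^r$. Let $\underline\beta=(\beta_0,\ldots,\beta_{r-1})$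 be a tuple of pairwise commuting elements of $\mathcal N_p(\mathfrak g)$, and let $\exp_{\underline\beta}$ be the homomorphism $$\exp_{\underline\beta}(s)=\exp_{\beta_0}(s)\cdot\exp_{\beta_1}(s^p)\cdots\exp_{\beta_{r-1}}(s^{p^{r-1}}).$$ The homomorphisms $\exp_{\underline\beta}$ and $\exp_{\beta_i}$ from $\mathbb G_a$ to $G$ restrict to homomorphisms $\mathbb G_{a(r)}\to G_{(r)}$, denoted by the same symbols. Let $M$ be any $G_{(r)}$-module, not necessarily finite-dimensional. Then the elements $$d\exp_{\underline\beta}(u_{r-1})\quad\text{and}\quad d\exp_{\beta_0}(u_{r-1})+d\exp_{\beta_1}(u_{r-2})+\cdots+d\exp_{\beta_{r-1}}(u_0)$$ of $Dist(G_{(r)})$ act on $M$ by endomorphisms whose $p$-th power is zero, and $M$ is projective as a $k[u]/(u^p)$-module with $u$ acting via the first element if and only if it is projective as a $k[u]/(u^p)$-module with $u$ acting via the second. -/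

import Mathlib

open scoped TensorProduct Polynomial MatrixGroups

noncomputable section

namespace FrobeniusKernels

/-! ### The affine group scheme `GL_n` -/

section GeneralLinear

/-- The coordinate algebra `k[GL_n] = k[x_ij, 1/det]`. -/
def GLRing (n : ℕ) (k : Type*) [Field k] : Type _ :=
  Localization.Away (Matrix.det (Matrix.mvPolynomialX (Fin n) (Fin n) k))

variable {n : ℕ} {k : Type*} [Field k]

instance : CommRing (GLRing n k) :=
  inferInstanceAs (CommRing (Localization.Away (Matrix.det (Matrix.mvPolynomialX (Fin n) (Fin n) k))))

instance : Algebra (MvPolynomial (Fin n × Fin n) k) (GLRing n k) :=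
  inferInstanceAs (Algebra (MvPolynomial (Fin n × Fin n) k)
    (Localization.Away (Matrix.det (Matrix.mvPolynomialX (Fin n) (Fin n) k))))

instance : IsLocalization.Away (Matrix.det (Matrix.mvPolynomialX (Fin n) (Fin n) k)) (GLRing n k) :=
  inferInstanceAs (IsLocalization.Away (Matrix.det (Matrix.mvPolynomialX (Fin n) (Fin n) k))
    (Localization.Away (Matrix.det (Matrix.mvPolynomialX (Fin n) (Fin n) k))))

instance : Algebra k (GLRing n k) :=
  inferInstanceAs (Algebra k (Localization.Away (Matrix.det (Matrix.mvPolynomialX (Fin n) (Fin n) k))))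

instance : IsScalarTower k (MvPolynomial (Fin n × Fin n) k) (GLRing n k) :=
  inferInstanceAs (IsScalarTower k (MvPolynomial (Fin n × Fin n) k)
    (Localization.Away (Matrix.det (Matrix.mvPolynomialX (Fin n) (Fin n) k))))

variable (n k) in
/-- The universal invertible matrix `(x_ij)`, a point of `GL_n` with values in `k[GL_n]`. -/
def univ : GL (Fin n) (GLRing n k) :=
  Matrix.GeneralLinearGroup.mk''
    ((Matrix.mvPolynomialX (Fin n) (Fin n) k).map
      (algebraMap (MvPolynomial (Fin n × Fin n) k) (GLRing n k)))
    (by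
      have h := IsLocalization.Away.algebraMap_isUnit (S := GLRing n k)
        (Matrix.det (Matrix.mvPolynomialX (Fin n) (Fin n) k))
      rwa [RingHom.map_det] at h)

theorem univ_apply (i j : Fin n) : univ n k i j =
    algebraMap (MvPolynomial (Fin n × Fin n) k) (GLRing n k) (MvPolynomial.X (i, j)) := rfl

variable {A B : Type*} [CommRing A] [Algebra k A] [CommRing B] [Algebra k B]

/-- The map `GL_n(A) → GL_n(B)` induced by a homomorphism `φ : A → B` of `k`-algebras. -/
abbrev glMap (φ : A →ₐ[k] B) : GL (Fin n) A →* GL (Fin n) B :=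
  Matrix.GeneralLinearGroup.map (φ : A →+* B)

/-- The identification `GL_n(A) = Hom(k[GL_n], A)`: evaluation of functions at `g ∈ GL_n(A)`. -/
def pointHom (g : GL (Fin n) A) : GLRing n k →ₐ[k] A :=
  IsLocalization.liftAlgHom
    (M := Submonoid.powers (Matrix.det (Matrix.mvPolynomialX (Fin n) (Fin n) k)))
    (f := MvPolynomial.aeval (R := k) (fun ij : Fin n × Fin n => (g : Matrix (Fin n) (Fin n) A) ij.1 ij.2))
    (by
      rintro ⟨_, m, rfl⟩
      have h : (MvPolynomial.aeval (R := k)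
          (fun ij : Fin n × Fin n => (g : Matrix (Fin n) (Fin n) A) ij.1 ij.2))
          (Matrix.det (Matrix.mvPolynomialX (Fin n) (Fin n) k)) =
          Matrix.det (g : Matrix (Fin n) (Fin n) A) := by
        rw [AlgHom.map_det]
        congr 1
        ext i j
        simp [Matrix.mvPolynomialX]
      simp only [map_pow, h]
      exact ((Matrix.isUnit_iff_isUnit_det _).1 g.isUnit).pow m)

theorem pointHom_univ (g : GL (Fin n) A) (i j : Fin n) :
    pointHom (k := k) g (univ n k i j) = g i j := by
  rw [univ_apply, pointHom, IsLocalization.liftAlgHom_apply, IsLocalization.lift_eq]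
  simp

theorem glMap_pointHom_univ (g : GL (Fin n) A) : glMap (pointHom (k := k) g) (univ n k) = g := by
  ext i j
  exact pointHom_univ g i j

theorem algHom_ext {φ ψ : GLRing n k →ₐ[k] A} (h : glMap φ (univ n k) = glMap ψ (univ n k)) :
    φ = ψ := by
  have h2 : (φ.comp (IsScalarTower.toAlgHom k (MvPolynomial (Fin n × Fin n) k) (GLRing n k))) =
      ψ.comp (IsScalarTower.toAlgHom k (MvPolynomial (Fin n × Fin n) k) (GLRing n k)) := by
    ext ⟨i, j⟩
    have := congrArg (fun g : GL (Fin n) A => g i j) h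
    simpa [univ_apply] using this
  apply AlgHom.coe_ringHom_injective
  apply IsLocalization.ringHom_ext
    (Submonoid.powers (Matrix.det (Matrix.mvPolynomialX (Fin n) (Fin n) k)))
  ext x
  · exact (φ.comp (IsScalarTower.toAlgHom k _ (GLRing n k))).commutes x |>.trans
      ((ψ.comp (IsScalarTower.toAlgHom k _ (GLRing n k))).commutes x).symm
  · exact congrArg (fun f => f (MvPolynomial.X x)) h2

theorem comp_pointHom (φ : A →ₐ[k] B) (g : GL (Fin n) A) :
    φ.comp (pointHom g) = pointHom (glMap φ g) := by
  apply algHom_ext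
  rw [glMap_pointHom_univ]
  ext i j
  simp [pointHom_univ]

theorem glMap_comp {C : Type*} [CommRing C] [Algebra k C] (ψ : B →ₐ[k] C) (φ : A →ₐ[k] B)
    (g : GL (Fin n) A) : glMap (ψ.comp φ) g = glMap ψ (glMap φ g) := rfl

variable (n k) in
/-- The comultiplication of `k[GL_n]`, dual to the product of two generic matrices:
`x_ij ↦ ∑ x_il ⊗ x_lj`. -/
def comulHom : GLRing n k →ₐ[k] GLRing n k ⊗[k] GLRing n k :=
  pointHom (glMap (Algebra.TensorProduct.includeLeft (R := k) (S := k)) (univ n k) *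
      glMap (Algebra.TensorProduct.includeRight (R := k)) (univ n k))

theorem comulHom_univ (i j : Fin n) :
    comulHom n k (univ n k i j) = ∑ l, univ n k i l ⊗ₜ[k] univ n k l j := by
  rw [comulHom, pointHom_univ]
  simp [Matrix.mul_apply]

/-- `k[GL_n]` is a bialgebra; the counit is evaluation at the identity matrix. -/
instance : Bialgebra k (GLRing n k) :=
  Bialgebra.ofAlgHom (comulHom n k) (pointHom 1)
    (by
      apply algHom_ext
      ext i j
      simp [comulHom_univ, TensorProduct.sum_tmul, TensorProduct.tmul_sum]
      rw [Finset.sum_comm])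
    (by
      apply algHom_ext
      ext i j
      simp [comulHom_univ, pointHom_univ, Matrix.one_apply, TensorProduct.ite_tmul])
    (by
      apply algHom_ext
      ext i j
      simp [comulHom_univ, pointHom_univ, Matrix.one_apply, TensorProduct.tmul_ite])

theorem comulAlgHom_eq : Bialgebra.comulAlgHom k (GLRing n k) = comulHom n k := rfl

theorem counitAlgHom_eq : Bialgebra.counitAlgHom k (GLRing n k) = pointHom 1 := rfl

/-- `k[GL_n]` is a Hopf algebra; the antipode is dual to inversion of matrices. -/
instance : HopfAlgebra k (GLRing n k) :=
  HopfAlgebra.ofAlgHom (pointHom (univ n k)⁻¹)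
    (by
      apply algHom_ext
      ext i j
      have h : ((univ n k)⁻¹ * univ n k) i j = (1 : GL (Fin n) (GLRing n k)) i j := by
        rw [inv_mul_cancel]
      rw [Units.val_mul, Matrix.mul_apply] at h
      simp only [comulAlgHom_eq, counitAlgHom_eq, Matrix.GeneralLinearGroup.map_apply,
        RingHom.coe_coe, AlgHom.comp_apply, comulHom_univ, map_sum, pointHom_univ]
      refine (Finset.sum_congr rfl fun l _ => (Algebra.TensorProduct.lift_tmul _ _ _ _ _).trans
        (by rw [pointHom_univ]; rfl)).trans (h.trans ?_)
      by_cases hij : i = j <;> simp [hij])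
    (by
      apply algHom_ext
      ext i j
      have h : (univ n k * (univ n k)⁻¹) i j = (1 : GL (Fin n) (GLRing n k)) i j := by
        rw [mul_inv_cancel]
      rw [Units.val_mul, Matrix.mul_apply] at h
      simp only [comulAlgHom_eq, counitAlgHom_eq, Matrix.GeneralLinearGroup.map_apply,
        RingHom.coe_coe, AlgHom.comp_apply, comulHom_univ, map_sum, pointHom_univ]
      refine (Finset.sum_congr rfl fun l _ => (Algebra.TensorProduct.lift_tmul _ _ _ _ _).trans
        (by rw [pointHom_univ]; rfl)).trans (h.trans ?_)
      by_cases hij : i = j <;> simp [hij])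

theorem antipode_eq : HopfAlgebra.antipode k (A := GLRing n k) = (pointHom (univ n k)⁻¹).toLinearMap :=
  rfl

/-- Points multiply by convolution. -/
theorem pointHom_mul (g h : GL (Fin n) A) :
    pointHom (k := k) (g * h) =
      (Algebra.TensorProduct.lift (pointHom g) (pointHom h) fun _ _ => Commute.all _ _).comp
        (Bialgebra.comulAlgHom k (GLRing n k)) := by
  apply algHom_ext
  ext i j
  simp [comulAlgHom_eq, comulHom_univ, pointHom_univ, Matrix.mul_apply]

end GeneralLinear

/-! ### Closed subgroups of `GL_n`

A closed subgroup scheme `G ⊆ GL_n` is given by a Hopf ideal `I` of `k[GL_n]`, and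
`k[G] = k[GL_n] / I`. -/

section ClosedSubgroup

variable {n : ℕ} {k : Type*} [Field k] (I : Ideal (GLRing n k)) [I.IsHopfIdeal k]
  {A B : Type*} [CommRing A] [Algebra k A] [CommRing B] [Algebra k B]

variable (A) in
/-- The group `G(A) = {g ∈ GL_n(A) | f(g) = 0 for all f ∈ I}`. -/
def points : Subgroup (GL (Fin n) A) where
  carrier := {g | ∀ f ∈ I, pointHom (k := k) g f = 0}
  mul_mem' := by
    intro g h hg hh f hf
    have h0 := Submodule.IsCoideal.map_mkQ_comul_eq_zero (I := I.restrictScalars k) hf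
    rw [pointHom_mul]
    let g' : (GLRing n k ⧸ I) →ₐ[k] A := Ideal.Quotient.liftₐ I (pointHom g) hg
    let h' : (GLRing n k ⧸ I) →ₐ[k] A := Ideal.Quotient.liftₐ I (pointHom h) hh
    have hcomp : (Algebra.TensorProduct.lift (pointHom (k := k) g) (pointHom h)
          fun _ _ => Commute.all _ _) =
        (Algebra.TensorProduct.lift g' h' fun _ _ => Commute.all _ _).comp
          (Algebra.TensorProduct.map (Ideal.Quotient.mkₐ k I) (Ideal.Quotient.mkₐ k I)) := by
      ext x <;> simp [g', h'] <;> rfl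
    rw [hcomp]
    have h1 : Algebra.TensorProduct.map (Ideal.Quotient.mkₐ k I) (Ideal.Quotient.mkₐ k I)
        (Coalgebra.comul f) = 0 := h0
    simp [h1]
  one_mem' := by
    intro f hf
    have h0 : pointHom (1 : GL (Fin n) k) f = 0 :=
      Submodule.IsCoideal.counit_eq_zero (I := I.restrictScalars k) hf
    have h1 : (pointHom (1 : GL (Fin n) A)) = (Algebra.ofId k A).comp (pointHom 1) := by
      rw [comp_pointHom, map_one]
    simp [h1, h0]
  inv_mem' := by
    intro g hg f hf
    have h0 : pointHom (univ n k)⁻¹ f ∈ I := Ideal.IsHopfIdeal.antipode_mem (R := k) hf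
    have h1 := hg _ h0
    have h2 : (pointHom (k := k) g).comp (pointHom (univ n k)⁻¹) = pointHom g⁻¹ := by
      rw [comp_pointHom, map_inv, glMap_pointHom_univ]
    rw [← h2]
    exact h1

theorem glMap_mem_points (φ : A →ₐ[k] B) {g : GL (Fin n) A} (hg : g ∈ points I A) :
    glMap φ g ∈ points I B := by
  intro f hf
  rw [← comp_pointHom, AlgHom.comp_apply, hg f hf, map_zero]

/-- The point `1 + εx` of `GL_n` with values in the dual numbers `k[ε]`. -/
def dualPoint (x : Matrix (Fin n) (Fin n) k) : GL (Fin n) (DualNumber k) where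
  val := 1 + x.map TrivSqZeroExt.inr
  inv := 1 - x.map TrivSqZeroExt.inr
  val_inv := by
    have : (x.map TrivSqZeroExt.inr : Matrix (Fin n) (Fin n) (DualNumber k)) *
        x.map TrivSqZeroExt.inr = 0 := by
      ext i j <;> simp [Matrix.mul_apply]
    noncomm_ring
    simp [this]
  inv_val := by
    have : (x.map TrivSqZeroExt.inr : Matrix (Fin n) (Fin n) (DualNumber k)) *
        x.map TrivSqZeroExt.inr = 0 := by
      ext i j <;> simp [Matrix.mul_apply]
    noncomm_ring
    simp [this]

/-- The Lie algebra of `G`, inside `gl_n`: `x ∈ Lie G` if and only if `1 + εx ∈ G(k[ε])`. -/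
def lieAlg : Set (Matrix (Fin n) (Fin n) k) :=
  {x | dualPoint x ∈ points I (DualNumber k)}

end ClosedSubgroup

/-! ### The additive group -/

section Additive

variable {k : Type*} [Field k]

/-- The coordinate algebra `k[t]` of the additive group `G_a` is a Hopf algebra, with
`Δ t = t ⊗ 1 + 1 ⊗ t`, `ε t = 0`. -/
instance : Bialgebra k k[X] :=
  Bialgebra.ofAlgHom (Polynomial.aeval (Polynomial.X ⊗ₜ[k] 1 + 1 ⊗ₜ[k] Polynomial.X))
    (Polynomial.aeval 0)
    (by
      ext
      simp [TensorProduct.add_tmul, TensorProduct.tmul_add, Algebra.TensorProduct.one_def, add_assoc])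
    (by ext; simp)
    (by ext; simp)

theorem comul_X : Coalgebra.comul (R := k) (Polynomial.X : k[X]) =
    Polynomial.X ⊗ₜ[k] 1 + 1 ⊗ₜ[k] Polynomial.X :=
  Polynomial.aeval_X _

theorem counit_X : Coalgebra.counit (R := k) (Polynomial.X : k[X]) = 0 :=
  Polynomial.aeval_X _

theorem counit_polynomial (f : k[X]) : Coalgebra.counit (R := k) f = f.coeff 0 := by
  rw [Polynomial.coeff_zero_eq_aeval_zero]
  rfl

instance : HopfAlgebra k k[X] :=
  HopfAlgebra.ofAlgHom (Polynomial.aeval (-Polynomial.X))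
    (by
      apply Polynomial.algHom_ext
      rw [AlgHom.comp_apply, AlgHom.comp_apply, Bialgebra.comulAlgHom_apply,
        Bialgebra.counitAlgHom_apply, comul_X, counit_X, map_add, map_zero]
      exact (congrArg₂ (· + ·) (Algebra.TensorProduct.lift_tmul _ _ _ _ _)
        (Algebra.TensorProduct.lift_tmul _ _ _ _ _)).trans (by simp))
    (by
      apply Polynomial.algHom_ext
      rw [AlgHom.comp_apply, AlgHom.comp_apply, Bialgebra.comulAlgHom_apply,
        Bialgebra.counitAlgHom_apply, comul_X, counit_X, map_add, map_zero]
      exact (congrArg₂ (· + ·) (Algebra.TensorProduct.lift_tmul _ _ _ _ _)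
        (Algebra.TensorProduct.lift_tmul _ _ _ _ _)).trans (by simp))

end Additive

/-! ### Frobenius kernels -/

section FrobeniusKernel

variable (k : Type*) [Field k] (p r : ℕ) (A : Type*) [CommRing A] [HopfAlgebra k A]

/-- The augmentation ideal of `k[H]`: the functions that vanish at the identity of `H`. -/
def augIdeal : Ideal A := RingHom.ker (Bialgebra.counitAlgHom k A)

/-- The ideal of `k[H]` that defines the `r`-th Frobenius kernel `H_(r)`: it is generated by the
`p^r`-th powers of the functions that vanish at the identity. For `H ⊆ GL_n` this is the ideal
generated by the functions `x_ij^(p^r) - δ_ij`, so that `H_(r)` is the kernel of the `r`-th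
iterate of the Frobenius morphism. -/
def frobIdeal : Ideal A := Ideal.span ((fun f => f ^ p ^ r) '' (augIdeal k A : Set A))

theorem mem_augIdeal {f : A} : f ∈ augIdeal k A ↔ Coalgebra.counit (R := k) f = 0 := Iff.rfl

theorem pow_mem_frobIdeal {f : A} (hf : f ∈ augIdeal k A) : f ^ p ^ r ∈ frobIdeal k p r A :=
  Ideal.subset_span ⟨f, hf, rfl⟩

/-- `Δ(I_ε) ⊆ I_ε ⊗ k[H] + k[H] ⊗ I_ε`. -/
theorem comul_mem_of_mem_augIdeal {f : A} (hf : f ∈ augIdeal k A) :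
    (Coalgebra.comul (R := k) f : A ⊗[k] A) ∈
      (augIdeal k A).map (Algebra.TensorProduct.includeLeft (R := k) (S := k) (A := A) (B := A)) ⊔
      (augIdeal k A).map (Algebra.TensorProduct.includeRight (R := k) (A := A) (B := A)) := by
  let R := Coalgebra.Repr.arbitrary k f
  have h1 : (Coalgebra.comul (R := k) f : A ⊗[k] A) =
      ∑ i ∈ R.index, (R.left i - algebraMap k A (Coalgebra.counit (R.left i))) ⊗ₜ[k] R.right i +
        1 ⊗ₜ[k] f := by
    have h2 : (1 : A) ⊗ₜ[k] f =
        ∑ i ∈ R.index, (algebraMap k A (Coalgebra.counit (R.left i))) ⊗ₜ[k] R.right i := by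
      conv_lhs => rw [← Coalgebra.sum_counit_smul R, TensorProduct.tmul_sum]
      refine Finset.sum_congr rfl fun i _ => ?_
      rw [Algebra.algebraMap_eq_smul_one, TensorProduct.smul_tmul]
    rw [h2, ← Finset.sum_add_distrib]
    conv_lhs => rw [← R.eq]
    refine Finset.sum_congr rfl fun i _ => ?_
    rw [← TensorProduct.add_tmul, sub_add_cancel]
  rw [h1]
  refine Ideal.add_mem _ (Ideal.sum_mem _ fun i _ => ?_) (Ideal.mem_sup_right ?_)
  · have h3 : (R.left i - algebraMap k A (Coalgebra.counit (R.left i))) ⊗ₜ[k] R.right i =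
        (1 ⊗ₜ[k] R.right i) * Algebra.TensorProduct.includeLeft (R := k) (S := k)
          (R.left i - algebraMap k A (Coalgebra.counit (R.left i))) := by
      simp
    rw [h3]
    refine Ideal.mem_sup_left (Ideal.mul_mem_left _ _ (Ideal.mem_map_of_mem _ ?_))
    rw [mem_augIdeal, map_sub, Bialgebra.counit_algebraMap, sub_self]
  · exact Ideal.mem_map_of_mem
      (Algebra.TensorProduct.includeRight (R := k) (A := A) (B := A)) hf

theorem frobIdeal_le_comap {k : Type*} [Field k] (p r : ℕ) {A B : Type*} [CommRing A]
    [HopfAlgebra k A] [CommRing B] [HopfAlgebra k B] (φ : A →ₐc[k] B) :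
    frobIdeal k p r A ≤ (frobIdeal k p r B).comap (φ : A →ₐ[k] B) := by
  refine Ideal.span_le.2 ?_
  rintro _ ⟨f, hf, rfl⟩
  have h1 : φ f ∈ augIdeal k B := by
    rw [mem_augIdeal, CoalgHomClass.counit_comp_apply]
    exact hf
  simpa using pow_mem_frobIdeal k p r B h1

variable [Fact p.Prime] [CharP k p]

instance : (frobIdeal k p r A).IsHopfIdeal k where
  counit_eq_zero := by
    have h : frobIdeal k p r A ≤ augIdeal k A := by
      rw [frobIdeal, Ideal.span_le]
      rintro _ ⟨f, hf, rfl⟩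
      exact Ideal.pow_mem_of_mem _ hf _ (pow_pos (Fact.out : p.Prime).pos _)
    exact fun x hx => h hx
  map_mkQ_comul_eq_zero := by
    let J := frobIdeal k p r A
    let π : A ⊗[k] A →ₐ[k] (A ⧸ J) ⊗[k] (A ⧸ J) :=
      Algebra.TensorProduct.map (Ideal.Quotient.mkₐ k J) (Ideal.Quotient.mkₐ k J)
    have hnt : Nontrivial (A ⊗[k] A) :=
      (Bialgebra.counitAlgHom k (A ⊗[k] A)).toRingHom.domain_nontrivial
    have hch : CharP (A ⊗[k] A) p :=
      charP_of_injective_algebraMap (algebraMap k (A ⊗[k] A)).injective p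
    have h : J ≤ RingHom.ker (π.comp (Bialgebra.comulAlgHom k A)) := by
      refine Ideal.span_le.2 ?_
      rintro _ ⟨f, hf, rfl⟩
      let φ : A ⊗[k] A →+* (A ⧸ J) ⊗[k] (A ⧸ J) :=
        (π : A ⊗[k] A →+* (A ⧸ J) ⊗[k] (A ⧸ J)).comp (iterateFrobenius (A ⊗[k] A) p r)
      have h1 : (Coalgebra.comul (R := k) f : A ⊗[k] A) ∈ RingHom.ker φ := by
        refine (sup_le ?_ ?_ : _ ≤ RingHom.ker φ) (comul_mem_of_mem_augIdeal k A hf)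
        · rw [Ideal.map_le_iff_le_comap]
          intro a ha
          have h2 : Ideal.Quotient.mk J (a ^ p ^ r) = 0 :=
            Ideal.Quotient.eq_zero_iff_mem.2 (pow_mem_frobIdeal k p r A ha)
          simp [φ, π, iterateFrobenius_def, h2]
        · rw [Ideal.map_le_iff_le_comap]
          intro a ha
          have h2 : Ideal.Quotient.mk J (a ^ p ^ r) = 0 :=
            Ideal.Quotient.eq_zero_iff_mem.2 (pow_mem_frobIdeal k p r A ha)
          simp [φ, π, iterateFrobenius_def, h2]
      rw [RingHom.mem_ker] at h1
      simpa [φ, iterateFrobenius_def] using h1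
    exact fun x hx => h hx
  antipode_mem := by
    have h : frobIdeal k p r A ≤
        (frobIdeal k p r A).comap (HopfAlgebra.antipodeAlgHom k A) := by
      refine Ideal.span_le.2 ?_
      rintro _ ⟨f, hf, rfl⟩
      have h1 : HopfAlgebra.antipode k f ∈ augIdeal k A := by
        rw [mem_augIdeal, HopfAlgebra.counit_antipode]
        exact hf
      have h2 : HopfAlgebra.antipodeAlgHom k A (f ^ p ^ r) = HopfAlgebra.antipode k f ^ p ^ r :=
        map_pow _ _ _
      simpa [h2] using pow_mem_frobIdeal k p r A h1
    exact fun x hx => h hx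

/-- The coordinate algebra `k[H_(r)]` of the `r`-th Frobenius kernel of `H`. -/
abbrev FrobKer : Type _ := A ⧸ frobIdeal k p r A

variable {k A} {B : Type*} [CommRing B] [HopfAlgebra k B]

/-- A morphism of affine group schemes `H₁ → H₂` (that is, a homomorphism `k[H₂] → k[H₁]` of
bialgebras) restricts to a morphism `(H₁)_(r) → (H₂)_(r)` of Frobenius kernels. -/
def frobRestrict (φ : A →ₐc[k] B) : FrobKer k p r A →ₐc[k] FrobKer k p r B :=
  BialgHom.ofAlgHom
    (Ideal.quotientMapₐ (frobIdeal k p r B) (φ : A →ₐ[k] B) (frobIdeal_le_comap p r φ))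
    (by
      apply Ideal.Quotient.algHom_ext
      ext x
      exact CoalgHomClass.counit_comp_apply φ x)
    (by
      apply Ideal.Quotient.algHom_ext
      refine AlgHom.ext fun x => ?_
      let ψ := (Ideal.quotientMapₐ (frobIdeal k p r B) (φ : A →ₐ[k] B)
        (frobIdeal_le_comap p r φ)).toLinearMap
      let mkA := (Ideal.Quotient.mkₐ k (frobIdeal k p r A)).toLinearMap
      let mkB := (Ideal.Quotient.mkₐ k (frobIdeal k p r B)).toLinearMap
      change TensorProduct.map ψ ψ (TensorProduct.map mkA mkA (Coalgebra.comul x)) =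
        TensorProduct.map mkB mkB (Coalgebra.comul (φ x))
      rw [← CoalgHomClass.map_comp_comul_apply φ x]
      simp only [TensorProduct.map_map]
      rfl)

end FrobeniusKernel

/-! ### Distribution algebras -/

section Distributions

variable (k : Type*) [Field k] (A : Type*) [CommRing A] [HopfAlgebra k A]

/-- The distribution algebra `Dist(H)`: the linear forms on `k[H]` that vanish on some power of the
augmentation ideal, with the convolution product `μν = (μ ⊗ ν) ∘ Δ`. -/
def Dist : Subalgebra k (WithConv (A →ₗ[k] k)) where
  carrier := {μ | ∃ m : ℕ, 1 ≤ m ∧ ∀ f ∈ augIdeal k A ^ m, μ f = 0}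
  mul_mem' := by
    rintro μ ν ⟨a, ha, hμ⟩ ⟨b, hb, hν⟩
    refine ⟨a + b, by omega, fun f hf => ?_⟩
    let K₁ := (augIdeal k A).map
      (Algebra.TensorProduct.includeLeft (R := k) (S := k) (A := A) (B := A))
    let K₂ := (augIdeal k A).map (Algebra.TensorProduct.includeRight (R := k) (A := A) (B := A))
    have h1 : augIdeal k A ^ (a + b) ≤
        ((K₁ ⊔ K₂) ^ (a + b)).comap (Bialgebra.comulAlgHom k A) :=
      (Ideal.pow_right_mono (fun x hx => comul_mem_of_mem_augIdeal k A hx) _).trans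
        (Ideal.le_comap_pow _ _)
    have h2 : (Coalgebra.comul (R := k) f : A ⊗[k] A) ∈ K₁ ^ a ⊔ K₂ ^ b :=
      Ideal.sup_pow_add_le_pow_sup_pow (h1 hf)
    let Φ : A ⊗[k] A →ₗ[k] k := LinearMap.mul' k k ∘ₗ TensorProduct.map μ.ofConv ν.ofConv
    have h3 : ∀ z ∈ K₁ ^ a, ∀ w, Φ (w * z) = 0 := by
      intro z hz
      rw [← Ideal.map_pow] at hz
      refine Submodule.span_induction ?_ (fun w => by rw [mul_zero, map_zero])
        (fun x y _ _ hx hy w => by rw [mul_add, map_add, hx, hy, add_zero])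
        (fun c x _ hx w => by rw [smul_eq_mul, ← mul_assoc, hx]) hz
      rintro _ ⟨c, hc, rfl⟩ w
      induction w with
      | zero => simp
      | add x y hx hy => rw [add_mul, map_add, hx, hy, add_zero]
      | tmul x y => simp [Φ, hμ _ (Ideal.mul_mem_left _ x hc)]
    have h4 : ∀ z ∈ K₂ ^ b, ∀ w, Φ (w * z) = 0 := by
      intro z hz
      rw [← Ideal.map_pow] at hz
      refine Submodule.span_induction ?_ (fun w => by rw [mul_zero, map_zero])
        (fun x y _ _ hx hy w => by rw [mul_add, map_add, hx, hy, add_zero])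
        (fun c x _ hx w => by rw [smul_eq_mul, ← mul_assoc, hx]) hz
      rintro _ ⟨c, hc, rfl⟩ w
      induction w with
      | zero => simp
      | add x y hx hy => rw [add_mul, map_add, hx, hy, add_zero]
      | tmul x y => simp [Φ, hν _ (Ideal.mul_mem_left _ y hc)]
    obtain ⟨z₁, hz₁, z₂, hz₂, hz⟩ := Submodule.mem_sup.1 h2
    change Φ (Coalgebra.comul f) = 0
    rw [← hz, map_add, ← one_mul z₁, ← one_mul z₂, h3 z₁ hz₁, h4 z₂ hz₂, add_zero]
  add_mem' := by
    rintro μ ν ⟨a, ha, hμ⟩ ⟨b, hb, hν⟩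
    refine ⟨a + b, by omega, fun f hf => ?_⟩
    have h1 := hμ f (Ideal.pow_le_pow_right (by omega) hf)
    have h2 := hν f (Ideal.pow_le_pow_right (by omega) hf)
    change μ.ofConv f + ν.ofConv f = 0
    rw [h1, h2, add_zero]
  algebraMap_mem' := by
    intro c
    refine ⟨1, le_rfl, fun f hf => ?_⟩
    rw [pow_one] at hf
    have h1 : Coalgebra.counit (R := k) f = 0 := hf
    simp [h1]

variable {k A} {B : Type*} [CommRing B] [HopfAlgebra k B]

/-- The homomorphism of algebras `dφ : Dist(H₁) → Dist(H₂)` induced by a morphism of affine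
group schemes `H₁ → H₂` with comorphism `φ : k[H₂] → k[H₁]`. -/
def distMap (φ : A →ₐc[k] B) : Dist k B →ₐ[k] Dist k A where
  toFun μ := ⟨WithConv.toConv (μ.1.ofConv ∘ₗ (φ : A →ₗc[k] B).toLinearMap), by
    obtain ⟨m, hm, h⟩ := μ.2
    refine ⟨m, hm, fun f hf => h (φ f) ?_⟩
    have h1 : augIdeal k A ≤ (augIdeal k B).comap (φ : A →ₐ[k] B) := fun x hx => by
      have h2 : Coalgebra.counit (R := k) (φ x) = 0 :=
        (CoalgHomClass.counit_comp_apply φ x).trans hx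
      exact h2
    exact ((Ideal.pow_right_mono h1 m).trans (Ideal.le_comap_pow _ _)) hf⟩
  map_one' := by
    refine Subtype.ext (WithConv.ext (LinearMap.ext fun x => ?_))
    exact CoalgHomClass.counit_comp_apply φ x
  map_mul' μ ν := Subtype.ext (WithConv.ext
    (LinearMap.convMul_comp_coalgHom_distrib μ.1 ν.1 (φ : A →ₗc[k] B)))
  map_zero' := rfl
  map_add' _ _ := rfl
  commutes' c := by
    refine Subtype.ext (WithConv.ext (LinearMap.ext fun x => ?_))
    exact congrArg (c * ·) (CoalgHomClass.counit_comp_apply φ x)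

end Distributions

section DistAdditive

variable {k : Type*} [Field k] (p r : ℕ)

theorem frobIdeal_polynomial_le :
    frobIdeal k p r k[X] ≤ Ideal.span {(Polynomial.X : k[X]) ^ p ^ r} := by
  refine Ideal.span_le.2 ?_
  rintro _ ⟨f, hf, rfl⟩
  refine Ideal.mem_span_singleton.2 (pow_dvd_pow_of_dvd ?_ _)
  exact Polynomial.X_dvd_iff.2 ((counit_polynomial f).symm.trans hf)

variable [Fact p.Prime] [CharP k p]

/-- The element `u_j = (d/dt)^(p^j)` of `Dist(G_a(r))`, for `j < r`: the linear form on
`k[G_a(r)] = k[t]/(t^(p^r))` with `t^i ↦ 1` if `i = p^j` and `t^i ↦ 0` otherwise. -/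
def uElt (j : ℕ) (hj : j < r) : Dist k (FrobKer k p r k[X]) :=
  ⟨WithConv.toConv (Submodule.liftQ ((frobIdeal k p r k[X]).restrictScalars k)
    (Polynomial.lcoeff k (p ^ j)) (by
      intro f hf
      have h1 := Ideal.mem_span_singleton.1 (frobIdeal_polynomial_le p r hf)
      exact Polynomial.X_pow_dvd_iff.1 h1 _
        (Nat.pow_lt_pow_right (Fact.out : p.Prime).one_lt hj))), by
    refine ⟨p ^ r, Nat.one_le_pow _ _ (Fact.out : p.Prime).pos, fun f hf => ?_⟩
    have h1 : augIdeal k (FrobKer k p r k[X]) ≤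
        Ideal.span {Ideal.Quotient.mk (frobIdeal k p r k[X]) Polynomial.X} := by
      intro g hg
      obtain ⟨g, rfl⟩ := Ideal.Quotient.mk_surjective g
      obtain ⟨c, rfl⟩ := Polynomial.X_dvd_iff.2 ((counit_polynomial g).symm.trans hg)
      exact Ideal.mem_span_singleton.2 ⟨_, map_mul _ _ _⟩
    have h2 : Ideal.Quotient.mk (frobIdeal k p r k[X]) Polynomial.X ^ p ^ r = 0 := by
      rw [← map_pow]
      exact Ideal.Quotient.eq_zero_iff_mem.2 (pow_mem_frobIdeal k p r k[X] counit_X)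
    have h3 := Ideal.pow_right_mono h1 (p ^ r) hf
    rw [Ideal.span_singleton_pow, h2, Ideal.span_singleton_zero, Ideal.mem_bot] at h3
    rw [h3]
    exact map_zero (Submodule.liftQ _ _ _)⟩

end DistAdditive

/-! ### Exponential maps -/

section Exponential

variable {n : ℕ} {k : Type*} [Field k] (p : ℕ) {A B : Type*} [CommRing A] [Algebra k A]
  [CommRing B] [Algebra k B]

variable (k) in
/-- The truncated exponential series `1 + y + y^2/2 + ... + y^(p-1)/(p-1)!`. -/
def truncExp (y : Matrix (Fin n) (Fin n) A) : Matrix (Fin n) (Fin n) A :=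
  ∑ j ∈ Finset.range p, ((j.factorial : k)⁻¹) • y ^ j

/-- The matrix `s • x` over `A`, for `x` a matrix over `k` and `s ∈ A`. -/
def scaled (x : Matrix (Fin n) (Fin n) k) (s : A) : Matrix (Fin n) (Fin n) A :=
  s • x.map (algebraMap k A)

theorem scaled_add (x : Matrix (Fin n) (Fin n) k) (s t : A) :
    scaled x (s + t) = scaled x s + scaled x t := add_smul _ _ _

theorem scaled_neg (x : Matrix (Fin n) (Fin n) k) (s : A) :
    scaled x (-s) = -scaled x s := neg_smul _ _

theorem scaled_mul (x y : Matrix (Fin n) (Fin n) k) (s t : A) :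
    scaled x s * scaled y t = scaled (x * y) (s * t) := by
  simp [scaled, smul_smul, mul_comm s t, Matrix.map_mul]

theorem scaled_pow (x : Matrix (Fin n) (Fin n) k) (s : A) (m : ℕ) :
    scaled x s ^ m = scaled (x ^ m) (s ^ m) := by
  induction m with
  | zero => simp [scaled]
  | succ m ih => rw [pow_succ, ih, scaled_mul, pow_succ, pow_succ]

theorem scaled_commute {x y : Matrix (Fin n) (Fin n) k} (h : Commute x y) (s t : A) :
    Commute (scaled x s) (scaled y t) := by
  rw [Commute, SemiconjBy, scaled_mul, scaled_mul, h.eq, mul_comm]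

theorem scaled_map (φ : A →ₐ[k] B) (x : Matrix (Fin n) (Fin n) k) (s : A) :
    (scaled x s).map φ = scaled x (φ s) := by
  ext i j
  simp [scaled]

variable [Fact p.Prime]

theorem truncExp_zero : truncExp k p (0 : Matrix (Fin n) (Fin n) A) = 1 := by
  rw [truncExp, Finset.sum_eq_single 0]
  · simp
  · intro b _ hb
    simp [hb]
  · intro h
    exact absurd (Finset.mem_range.2 (Fact.out : p.Prime).pos) h

variable [CharP k p]

theorem factorial_ne_zero_of_lt {m : ℕ} (hm : m < p) : (m.factorial : k) ≠ 0 := by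
  intro h
  rw [CharP.cast_eq_zero_iff k p, (Fact.out : p.Prime).dvd_factorial] at h
  omega

theorem truncExp_add {y z : Matrix (Fin n) (Fin n) A} (hyz : Commute y z)
    (h : ∀ i j, p ≤ i + j → y ^ i * z ^ j = 0) :
    truncExp k p (y + z) = truncExp k p y * truncExp k p z := by
  let g : ℕ × ℕ → Matrix (Fin n) (Fin n) A := fun q =>
    (((q.1.factorial : k)⁻¹) • y ^ q.1) * (((q.2.factorial : k)⁻¹) • z ^ q.2)
  let S := (Finset.range p ×ˢ Finset.range p).filter fun q : ℕ × ℕ => q.1 + q.2 < p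
  have h1 : truncExp k p y * truncExp k p z = ∑ q ∈ S, g q := by
    rw [truncExp, truncExp, Finset.sum_mul_sum, ← Finset.sum_product']
    refine (Finset.sum_subset (Finset.filter_subset _ _) fun q hq hq' => ?_).symm
    have hle : p ≤ q.1 + q.2 := by
      by_contra hlt
      exact hq' (Finset.mem_filter.2 ⟨hq, by omega⟩)
    simp [h _ _ hle]
  have h2 : ∀ q ∈ S, q.1 + q.2 ∈ Finset.range p := fun q hq =>
    Finset.mem_range.2 (Finset.mem_filter.1 hq).2
  rw [h1, ← Finset.sum_fiberwise_of_maps_to h2, truncExp]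
  refine Finset.sum_congr rfl fun m hm => ?_
  have hm' := Finset.mem_range.1 hm
  have h3 : S.filter (fun q : ℕ × ℕ => q.1 + q.2 = m) = Finset.HasAntidiagonal.antidiagonal m := by
    ext q
    simp only [S, Finset.mem_filter, Finset.mem_product, Finset.mem_range,
      Finset.HasAntidiagonal.mem_antidiagonal]
    omega
  rw [h3, hyz.add_pow', Finset.smul_sum]
  refine Finset.sum_congr rfl fun q hq => ?_
  rw [Finset.HasAntidiagonal.mem_antidiagonal] at hq
  have hq1 := factorial_ne_zero_of_lt (k := k) p (m := q.1) (by omega)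
  have hq2 := factorial_ne_zero_of_lt (k := k) p (m := q.2) (by omega)
  have hm0 := factorial_ne_zero_of_lt (k := k) p hm'
  have h4 : (m.choose q.1 : k) * q.1.factorial * q.2.factorial = m.factorial := by
    have h5 := Nat.choose_mul_factorial_mul_factorial (n := m) (k := q.1) (by omega)
    rw [show m - q.1 = q.2 by omega] at h5
    exact_mod_cast congrArg (Nat.cast (R := k)) h5
  change _ = (((q.1.factorial : k)⁻¹) • y ^ q.1) * (((q.2.factorial : k)⁻¹) • z ^ q.2)
  rw [smul_mul_smul_comm, ← Nat.cast_smul_eq_nsmul k, smul_smul]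
  congr 1
  field_simp
  linear_combination h4

theorem truncExp_scaled_add {x : Matrix (Fin n) (Fin n) k} (hx : x ^ p = 0) (s t : A) :
    truncExp k p (scaled x (s + t)) = truncExp k p (scaled x s) * truncExp k p (scaled x t) := by
  rw [scaled_add]
  refine truncExp_add p (scaled_commute (Commute.refl x) s t) fun i j hij => ?_
  rw [scaled_pow, scaled_pow, scaled_mul, ← pow_add, ← Nat.sub_add_cancel hij, pow_add x, hx]
  simp [scaled]

/-- The point `exp_x(s) = 1 + sx + (sx)^2/2 + ... + (sx)^(p-1)/(p-1)!` of `GL_n(A)`, for `s ∈ A` and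
`x ∈ gl_n` with `x^p = 0`. -/
def expPoint (x : Matrix (Fin n) (Fin n) k) (hx : x ^ p = 0) (s : A) : GL (Fin n) A where
  val := truncExp k p (scaled x s)
  inv := truncExp k p (scaled x (-s))
  val_inv := by
    rw [← truncExp_scaled_add p hx, add_neg_cancel]
    simp [scaled, truncExp_zero]
  inv_val := by
    rw [← truncExp_scaled_add p hx, neg_add_cancel]
    simp [scaled, truncExp_zero]

theorem expPoint_add (x : Matrix (Fin n) (Fin n) k) (hx : x ^ p = 0) (s t : A) :
    expPoint p x hx (s + t) = expPoint p x hx s * expPoint p x hx t :=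
  Units.ext (truncExp_scaled_add p hx s t)

theorem expPoint_zero (x : Matrix (Fin n) (Fin n) k) (hx : x ^ p = 0) :
    expPoint p x hx (0 : A) = 1 := by
  refine Units.ext ?_
  simp [expPoint, scaled, truncExp_zero]

theorem glMap_expPoint (φ : A →ₐ[k] B) (x : Matrix (Fin n) (Fin n) k) (hx : x ^ p = 0) (s : A) :
    glMap φ (expPoint p x hx s) = expPoint p x hx (φ s) := by
  refine Units.ext ?_
  change φ.mapMatrix (truncExp k p (scaled x s)) = truncExp k p (scaled x (φ s))
  simp only [truncExp, map_sum, map_smul, map_pow]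
  rw [AlgHom.mapMatrix_apply, scaled_map]

theorem expPoint_commute {x y : Matrix (Fin n) (Fin n) k} (hx : x ^ p = 0) (hy : y ^ p = 0)
    (h : Commute x y) (s t : A) : Commute (expPoint p x hx s) (expPoint p y hy t) := by
  refine Units.ext ?_
  change Commute (truncExp k p (scaled x s)) (truncExp k p (scaled y t))
  refine Commute.sum_left _ _ _ fun i _ => Commute.sum_right _ _ _ fun j _ => ?_
  exact (((scaled_commute h s t).pow_pow i j).smul_left _).smul_right _

variable {r : ℕ}

/-- The point `exp_β(s) = exp_{β_0}(s) exp_{β_1}(s^p) ⋯ exp_{β_{r-1}}(s^(p^(r-1)))` of `GL_n(A)`. -/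
def expTuplePoint (β : Fin r → Matrix (Fin n) (Fin n) k) (hβ : ∀ i, β i ^ p = 0) (s : A) :
    GL (Fin n) A :=
  (List.ofFn fun i : Fin r => expPoint p (β i) (hβ i) (s ^ p ^ (i : ℕ))).prod

theorem glMap_expTuplePoint (φ : A →ₐ[k] B) (β : Fin r → Matrix (Fin n) (Fin n) k)
    (hβ : ∀ i, β i ^ p = 0) (s : A) :
    glMap φ (expTuplePoint p β hβ s) = expTuplePoint p β hβ (φ s) := by
  rw [expTuplePoint, map_list_prod, List.map_ofFn, expTuplePoint]
  congr 2
  funext i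
  simp only [Function.comp_apply, glMap_expPoint, map_pow]

theorem prod_ofFn_mul {G : Type*} [Group G] {r : ℕ} (f g : Fin r → G)
    (h : ∀ i j, Commute (f i) (g j)) :
    (List.ofFn fun i => f i * g i).prod = (List.ofFn f).prod * (List.ofFn g).prod := by
  induction r with
  | zero => simp
  | succ r ih =>
    simp only [List.ofFn_succ, List.prod_cons]
    rw [ih (fun i => f i.succ) (fun i => g i.succ) fun i j => h _ _]
    have h1 : Commute (g 0) (List.ofFn fun i => f (Fin.succ i)).prod := by
      refine (Commute.list_prod_left _ _ fun a ha => ?_).symm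
      obtain ⟨i, rfl⟩ := (List.mem_ofFn' _ _).1 ha
      exact h _ _
    rw [mul_assoc, ← mul_assoc (g 0), h1.eq]
    simp only [mul_assoc]

theorem expTuplePoint_add [CharP A p] (β : Fin r → Matrix (Fin n) (Fin n) k)
    (hβ : ∀ i, β i ^ p = 0) (hc : ∀ i j, Commute (β i) (β j)) (s t : A) :
    expTuplePoint p β hβ (s + t) = expTuplePoint p β hβ s * expTuplePoint p β hβ t := by
  rw [expTuplePoint, expTuplePoint, expTuplePoint,
    ← prod_ofFn_mul _ _ fun i j => expPoint_commute p _ _ (hc i j) _ _]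
  congr 2
  funext i
  rw [add_pow_char_pow, expPoint_add]

theorem expTuplePoint_zero (β : Fin r → Matrix (Fin n) (Fin n) k) (hβ : ∀ i, β i ^ p = 0) :
    expTuplePoint p β hβ (0 : A) = 1 := by
  rw [expTuplePoint]
  refine List.prod_eq_one fun a ha => ?_
  obtain ⟨i, rfl⟩ := (List.mem_ofFn' _ _).1 ha
  have : p ^ (i : ℕ) ≠ 0 := (pow_pos (Fact.out : p.Prime).pos _).ne'
  change expPoint p (β i) (hβ i) ((0 : A) ^ p ^ (i : ℕ)) = 1
  rw [zero_pow this, expPoint_zero]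

end Exponential

/-! ### Subgroups of exponential type -/

section ExponentialType

variable {n : ℕ} {k : Type*} [Field k] (p : ℕ) (I : Ideal (GLRing n k)) [I.IsHopfIdeal k]

/-- `N_p(g)`: the `p`-nilpotent elements of the Lie algebra `g ⊆ gl_n` of `G`. -/
def nilCone : Set (Matrix (Fin n) (Fin n) k) := {x | x ∈ lieAlg I ∧ x ^ p = 0}

/-- `C_r(N_p(g))`: the `r`-tuples of pairwise commuting `p`-nilpotent elements of `g`. -/
def commTuples (r : ℕ) : Set (Fin r → Matrix (Fin n) (Fin n) k) :=
  {β | (∀ i, β i ∈ nilCone p I) ∧ ∀ i j, ⁅β i, β j⁆ = 0}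

/-- A morphism of group schemes `G_a → G` given by the image `g ∈ G(k[t])` of the generic point `t`,
which has to satisfy `g(s + s') = g(s) g(s')` and `g(0) = 1`. -/
def homOfPoint (g : GL (Fin n) k[X]) (hg : g ∈ points I k[X])
    (h0 : glMap (Bialgebra.counitAlgHom k k[X]) g = 1)
    (hmul : glMap (Bialgebra.comulAlgHom k k[X]) g =
      glMap (Algebra.TensorProduct.includeLeft (R := k) (S := k)) g *
        glMap (Algebra.TensorProduct.includeRight (R := k)) g) :
    (GLRing n k ⧸ I) →ₐc[k] k[X] :=
  BialgHom.ofAlgHom (Ideal.Quotient.liftₐ I (pointHom g) hg)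
    (by
      apply Ideal.Quotient.algHom_ext
      refine AlgHom.ext fun x => ?_
      exact congrArg (fun f => f x) ((comp_pointHom _ _).trans (congrArg pointHom h0)))
    (by
      apply Ideal.Quotient.algHom_ext
      have h1 : (Bialgebra.comulAlgHom k k[X]).comp (pointHom g) =
          (Algebra.TensorProduct.map (pointHom g) (pointHom g)).comp
            (Bialgebra.comulAlgHom k (GLRing n k)) := by
        rw [comp_pointHom, hmul, pointHom_mul, ← comp_pointHom, ← comp_pointHom]
        congr 1
        ext <;> simp
      refine AlgHom.ext fun x => ?_
      refine Eq.trans ?_ (congrArg (fun f => f x) h1).symm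
      let ψ := (Ideal.Quotient.liftₐ I (pointHom (k := k) g) hg).toLinearMap
      let mkA := (Ideal.Quotient.mkₐ k I).toLinearMap
      change TensorProduct.map ψ ψ (TensorProduct.map mkA mkA (Coalgebra.comul x)) =
        TensorProduct.map (pointHom g).toLinearMap (pointHom g).toLinearMap (Coalgebra.comul x)
      rw [← LinearMap.comp_apply, ← TensorProduct.map_comp]
      rfl)

variable [Fact p.Prime] [CharP k p]

/-- `G ⊆ GL_n` is of exponential type if for each `p`-nilpotent `x ∈ g` the morphism
`exp_x : G_a → GL_n` factors through `G`, that is, its value at the generic point `t` of `G_a`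
lies in `G(k[t])`. -/
def IsExponentialType : Prop :=
  ∀ x, ∀ hx : x ∈ nilCone p I, expPoint p x hx.2 (Polynomial.X : k[X]) ∈ points I k[X]

variable {p I} (hI : IsExponentialType p I)

/-- The morphism `exp_x : G_a → G`, for `x ∈ N_p(g)`. -/
def expHom {x : Matrix (Fin n) (Fin n) k} (hx : x ∈ nilCone p I) :
    (GLRing n k ⧸ I) →ₐc[k] k[X] :=
  homOfPoint I (expPoint p x hx.2 Polynomial.X) (hI x hx)
    (by
      rw [glMap_expPoint, Bialgebra.counitAlgHom_apply, counit_X, expPoint_zero])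
    (by
      rw [glMap_expPoint, glMap_expPoint, glMap_expPoint, Bialgebra.comulAlgHom_apply, comul_X,
        expPoint_add]
      rfl)

/-- The morphism `exp_β : G_a → G`, `s ↦ exp_{β_0}(s) exp_{β_1}(s^p) ⋯ exp_{β_{r-1}}(s^(p^(r-1)))`,
for `β ∈ C_r(N_p(g))`. -/
def expTupleHom {r : ℕ} {β : Fin r → Matrix (Fin n) (Fin n) k} (hβ : β ∈ commTuples p I r) :
    (GLRing n k ⧸ I) →ₐc[k] k[X] :=
  homOfPoint I (expTuplePoint p β (fun i => (hβ.1 i).2) Polynomial.X)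
    (by
      refine Subgroup.list_prod_mem _ fun a ha => ?_
      obtain ⟨i, rfl⟩ := (List.mem_ofFn' _ _).1 ha
      have h1 := glMap_mem_points I (Polynomial.aeval (R := k) ((Polynomial.X : k[X]) ^ p ^ (i : ℕ)))
        (hI _ (hβ.1 i))
      rwa [glMap_expPoint, Polynomial.aeval_X] at h1)
    (by
      rw [glMap_expTuplePoint, Bialgebra.counitAlgHom_apply, counit_X, expTuplePoint_zero])
    (by
      have hnt : Nontrivial (k[X] ⊗[k] k[X]) :=
        (Bialgebra.counitAlgHom k (k[X] ⊗[k] k[X])).toRingHom.domain_nontrivial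
      have hch : CharP (k[X] ⊗[k] k[X]) p :=
        charP_of_injective_algebraMap (algebraMap k (k[X] ⊗[k] k[X])).injective p
      rw [glMap_expTuplePoint, glMap_expTuplePoint, glMap_expTuplePoint,
        Bialgebra.comulAlgHom_apply, comul_X,
        expTuplePoint_add p β _ fun i j => sub_eq_zero.1 (hβ.2 i j)]
      rfl)

end ExponentialType

/-! ### Modules -/

section Modules

/-- A module for the affine group scheme `H` with coordinate algebra `A = k[H]`: a vector space `M`
with a coaction `M → M ⊗ k[H]` that is coassociative and counital. -/
class GroupModule (k : Type*) [Field k] (A : Type*) [CommRing A] [HopfAlgebra k A]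
    (M : Type*) [AddCommGroup M] [Module k M] where
  coact : M →ₗ[k] M ⊗[k] A
  coact_coassoc : (TensorProduct.assoc k M A A).toLinearMap ∘ₗ coact.rTensor A ∘ₗ coact =
    (Coalgebra.comul (R := k) (A := A)).lTensor M ∘ₗ coact
  coact_counit : (TensorProduct.rid k M).toLinearMap ∘ₗ
    (Coalgebra.counit (R := k) (A := A)).lTensor M ∘ₗ coact = LinearMap.id

variable {k : Type*} [Field k] {A : Type*} [CommRing A] [HopfAlgebra k A]
  (M : Type*) [AddCommGroup M] [Module k M] [GroupModule k A M]

/-- The action of `Dist(H)` on an `H`-module: `μ` acts by `M → M ⊗ k[H] → M ⊗ k = M`, the coaction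
followed by `id ⊗ μ`. -/
def distAction : Dist k A →ₐ[k] Module.End k M where
  toFun μ := (TensorProduct.rid k M).toLinearMap ∘ₗ μ.1.ofConv.lTensor M ∘ₗ GroupModule.coact
  map_one' := GroupModule.coact_counit
  map_mul' μ ν := by
    ext m
    let T : A ⊗[k] A →ₗ[k] k := LinearMap.mul' k k ∘ₗ TensorProduct.map μ.1.ofConv ν.1.ofConv
    have h1 : ∀ (a : A) (v : M ⊗[k] A),
        TensorProduct.rid k M (T.lTensor M (TensorProduct.assoc k M A A (v ⊗ₜ a))) =
          ν.1.ofConv a • TensorProduct.rid k M (μ.1.ofConv.lTensor M v) := by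
      intro a v
      induction v with
      | zero => simp
      | add x y hx hy => simp only [TensorProduct.add_tmul, map_add, hx, hy, smul_add]
      | tmul x y => simp [T, smul_smul, mul_comm]
    have h2 : ∀ w : M ⊗[k] A,
        TensorProduct.rid k M (T.lTensor M (TensorProduct.assoc k M A A
          (GroupModule.coact.rTensor A w))) =
        TensorProduct.rid k M (μ.1.ofConv.lTensor M (GroupModule.coact
          (TensorProduct.rid k M (ν.1.ofConv.lTensor M w)))) := by
      intro w
      induction w with
      | zero => simp
      | add x y hx hy => simp only [map_add, hx, hy]
      | tmul x y => simp [h1]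
    refine Eq.trans ?_ (h2 (GroupModule.coact m))
    have h3 := LinearMap.congr_fun (GroupModule.coact_coassoc (k := k) (A := A) (M := M)) m
    simp only [LinearMap.comp_apply, LinearEquiv.coe_coe] at h3
    rw [h3, ← LinearMap.comp_apply (T.lTensor M), ← LinearMap.lTensor_comp]
    rfl
  map_zero' := by
    ext m
    simp
  map_add' μ ν := by
    ext m
    simp [LinearMap.lTensor_add]
  commutes' c := by
    ext m
    have h1 := LinearMap.congr_fun (GroupModule.coact_counit (k := k) (A := A) (M := M)) m
    refine Eq.trans ?_ (congrArg (c • ·) h1)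
    simp only [LinearMap.comp_apply, LinearEquiv.coe_coe]
    rw [← map_smul, ← LinearMap.smul_apply, ← LinearMap.lTensor_smul]
    rfl

variable {M}

/-- The `k[u]/(u^p)`-module structure on a vector space `M` for which `u` acts via `x`. -/
abbrev truncModule {p : ℕ} (x : Module.End k M) (hx : x ^ p = 0) :
    Module (k[X] ⧸ Ideal.span {(Polynomial.X : k[X]) ^ p}) M :=
  Module.compHom M (Ideal.Quotient.lift (Ideal.span {(Polynomial.X : k[X]) ^ p})
    (Polynomial.aeval x : k[X] →ₐ[k] Module.End k M).toRingHom (by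
      intro f hf
      obtain ⟨g, rfl⟩ := Ideal.mem_span_singleton.1 hf
      simp [hx]))

/-- `M` is projective as a `k[u]/(u^p)`-module with `u` acting via `x`. -/
def ProjectiveVia {p : ℕ} (x : Module.End k M) (hx : x ^ p = 0) : Prop :=
  letI := truncModule x hx
  Module.Projective (k[X] ⧸ Ideal.span {(Polynomial.X : k[X]) ^ p}) M

end Modules

end FrobeniusKernels

end

/-!
Write `v_n` for the linear form on `k[G_a(r)]` that takes the coefficient of `t^n`, so that
`u_j = v_(p^j)`. Expanding `exp_β(t) = ∏ exp_{β_i}(t^(p^i))` in powers of `t` gives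
`d exp_β(v_m) = ∑ ∏ d exp_{β_i}(v_{b_i})`, summed over the tuples `b` with `∑ b_i p^i = m`
(`distMap_expTupleHom_divElt`). For `m = p^(r-1)`, the tuples with only one nonzero entry contribute
exactly `∑ d exp_{β_i}(u_{r-1-i})`, and every other term is a product of at least two of the elements
`d exp_{β_i}(v_b)`, `b > 0` (`exists_distMap_expTupleHom_eq`). These elements commute
(`commute_expDiv`), and their `p`-th powers vanish, since `v_a v_b = (a+b choose a) v_{a+b}` and `p`
divides `(pb choose b)` (`divElt_pow`). So the two elements of the theorem lie in the non-unital
commutative algebra `𝔪` that they generate, where `p`-th powers vanish, and agree modulo `𝔪²`.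

It remains to see that, for commuting endomorphisms `a, b, c` of a vector space `M` of any dimension
with `a^p = b^p = c^p = 0`, projectivity with `u` acting via `a` implies projectivity with `u` acting
via `a + bc`. By Higman's criterion (`projectiveVia_iff_higmanSplit`), projectivity via `a` means
that the identity of `M` is a relative trace `∑ a^i h a^(p-1-i)`, and it is also equivalent to
`ker a ⊆ im a^(p-1)`. The first form is stable under adding a nilpotent central multiple of any
operator (`HigmanSplit.add_smul`), so it passes from `a` on `M` to `a + tb` on `k[t]/(t^p) ⊗ M`. The
specialization `t ↦ c` maps this module onto `M`, and a short computation that uses `b^p = 0` lifts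
elements of `ker (a + bc)` to `ker (a + tb)` (`HigmanSplit.add_mul_action`).
-/

noncomputable section

namespace FrobeniusKernels

/-! ### Projectivity over truncated polynomial rings -/

section RelativeTrace

variable {E : Type*} [Ring E] (p : ℕ)

/-- The relative trace `∑ x^i h x^(p-1-i)` of `h` with respect to an element `x` with `x^p = 0`.
It commutes with `x`. -/
def relTrace (x h : E) : E := ∑ i ∈ Finset.range p, x ^ i * h * x ^ (p - 1 - i)

/-- Higman's condition: `1` is a relative trace. For `E = End_k(M)` this says that `M` is projective
over `k[u]/(u^p)` with `u` acting via `x`. -/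
def HigmanSplit (x : E) : Prop := ∃ h, relTrace p x h = 1

variable {p}

theorem commute_relTrace {x : E} (hx : x ^ p = 0) (h : E) : Commute x (relTrace p x h) := by
  rcases p with _ | p
  · simp [relTrace]
  rw [Commute, SemiconjBy, relTrace, Finset.mul_sum, Finset.sum_mul, ← sub_eq_zero,
    ← Finset.sum_sub_distrib]
  let f : ℕ → E := fun i => x ^ i * h * x ^ (p + 1 - i)
  calc _ = ∑ i ∈ Finset.range (p + 1), (f (i + 1) - f i) := by
        refine Finset.sum_congr rfl fun i hi => ?_
        have hi := Finset.mem_range.1 hi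
        simp only [f]
        rw [pow_succ' x i, mul_assoc _ _ x, ← pow_succ, show p + 1 - 1 - i + 1 = p + 1 - i by omega,
          show p + 1 - 1 - i = p + 1 - (i + 1) by omega]
        simp only [mul_assoc]
    _ = 0 := by rw [Finset.sum_range_sub]; simp [f, hx]

theorem HigmanSplit.of_isUnit {x h : E} (hx : x ^ p = 0) (hu : IsUnit (relTrace p x h)) :
    HigmanSplit p x := by
  obtain ⟨u, hu⟩ := hu
  refine ⟨h * ↑u⁻¹, ?_⟩
  have hc : Commute (↑u⁻¹ : E) x := (hu ▸ commute_relTrace hx h).symm.units_inv_left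
  calc relTrace p x (h * ↑u⁻¹) = relTrace p x h * ↑u⁻¹ := by
        rw [relTrace, relTrace, Finset.sum_mul]
        refine Finset.sum_congr rfl fun i _ => ?_
        simp only [mul_assoc, (hc.pow_right (p - 1 - i)).eq]
    _ = 1 := by rw [← hu, Units.mul_inv]

end RelativeTrace

section Exactness

variable {R : Type*} [Ring R] {M : Type*} [AddCommGroup M] [Module R M] {p : ℕ}

theorem relTrace_apply_of_apply_eq_zero (hp : p ≠ 0) {x : Module.End R M} (h : Module.End R M)
    {z : M} (hz : x z = 0) : relTrace p x h z = (x ^ (p - 1)) (h z) := by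
  obtain ⟨p, rfl⟩ := Nat.exists_eq_succ_of_ne_zero hp
  rw [relTrace, LinearMap.sum_apply, Finset.sum_range_succ, Finset.sum_eq_zero, zero_add]
  · simp
  · intro i hi
    have hi := Finset.mem_range.1 hi
    obtain ⟨j, hj⟩ : ∃ j, p.succ - 1 - i = j + 1 := ⟨p - i - 1, by omega⟩
    simp only [hj, pow_succ x j, Module.End.mul_apply, hz, map_zero]

theorem HigmanSplit.exists_pow_apply_eq (hp : p ≠ 0) {x : Module.End R M} (h : HigmanSplit p x) {z : M}
    (hz : x z = 0) : ∃ y, (x ^ (p - 1)) y = z := by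
  obtain ⟨h, hh⟩ := h
  exact ⟨h z, by rw [← relTrace_apply_of_apply_eq_zero hp h hz, hh, Module.End.one_apply]⟩

theorem HigmanSplit.exists_apply_eq {x : Module.End R M} (h : HigmanSplit p x) {z : M}
    (hz : (x ^ (p - 1)) z = 0) : ∃ y, x y = z := by
  obtain ⟨h, hh⟩ := h
  have h1 := LinearMap.congr_fun hh z
  rw [relTrace, LinearMap.sum_apply] at h1
  rcases p with _ | p
  · exact ⟨0, by simpa using h1⟩
  rw [Finset.sum_range_succ'] at h1
  refine ⟨∑ i ∈ Finset.range p, (x ^ i * h * x ^ (p + 1 - 1 - (i + 1))) z, ?_⟩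
  have hz' : (x ^ p) z = 0 := hz
  rw [map_sum]
  simpa [pow_succ', hz'] using h1

end Exactness

/-- Over a field, Higman's condition holds as soon as `ker x ⊆ im x^(p-1)`. -/
theorem HigmanSplit.of_exact {k : Type*} [Field k] {M : Type*} [AddCommGroup M] [Module k M]
    {p : ℕ} (hp : p ≠ 0) {x : Module.End k M} (hx : x ^ p = 0)
    (hex : ∀ z, x z = 0 → ∃ y, (x ^ (p - 1)) y = z) : HigmanSplit p x := by
  obtain ⟨p, rfl⟩ := Nat.exists_eq_succ_of_ne_zero hp
  let K := LinearMap.ker x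
  have hK : ∀ y, (x ^ p) y ∈ K := fun y => by
    rw [LinearMap.mem_ker, ← Module.End.mul_apply, ← pow_succ', hx, LinearMap.zero_apply]
  obtain ⟨g, hg⟩ := ((x ^ p).codRestrict K hK).exists_rightInverse_of_surjective (by
    refine LinearMap.range_eq_top.2 fun z => ?_
    obtain ⟨y, hy⟩ := hex z z.2
    exact ⟨y, Subtype.ext hy⟩)
  obtain ⟨h, hh⟩ := g.exists_extend
  have hhK : ∀ z ∈ K, (x ^ p) (h z) = z := fun z hz => by
    have h1 := LinearMap.congr_fun hg ⟨z, hz⟩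
    have h2 := LinearMap.congr_fun hh ⟨z, hz⟩
    have h3 := congrArg Subtype.val h1
    simp only [LinearMap.comp_apply, Submodule.subtype_apply] at h2
    rw [h2]
    exact h3
  -- `h` inverts `x^p` on `ker x`, so its trace `u` is the identity on `ker x`. Since `u` commutes
  -- with `x`, `u - 1` maps `ker x^(j+1)` to `ker x^j` and is nilpotent.
  let u := relTrace (p + 1) x h
  have hux : Commute x (u - 1) := (commute_relTrace hx h).sub_right (Commute.one_right x)
  have huK : ∀ z ∈ K, (u - 1) z = 0 := by
    intro z hz
    rw [LinearMap.sub_apply, Module.End.one_apply, sub_eq_zero]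
    exact (relTrace_apply_of_apply_eq_zero hp h hz).trans (hhK z hz)
  have hnil : ∀ j z, (x ^ j) z = 0 → ((u - 1) ^ j) z = 0 := by
    intro j
    induction j with
    | zero => exact fun z hz => hz
    | succ j ih =>
      intro z hz
      rw [pow_succ, Module.End.mul_apply]
      refine ih _ ?_
      rw [← Module.End.mul_apply, (hux.pow_left j).eq, Module.End.mul_apply]
      refine huK _ ?_
      rw [LinearMap.mem_ker, ← Module.End.mul_apply, ← pow_succ', hz]
  have hn : IsNilpotent (u - 1) := ⟨p + 1, LinearMap.ext fun z => hnil _ z (by rw [hx]; rfl)⟩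
  refine HigmanSplit.of_isUnit (h := h) hx ?_
  have h1 := hn.isUnit_one_add
  rwa [add_sub_cancel] at h1

section TruncatedAction

variable {k : Type*} [Field k] {p : ℕ}

variable (k p) in
/-- The truncated polynomial ring `k[u]/(u^p)`. -/
abbrev TruncPoly : Type _ := k[X] ⧸ Ideal.span {(Polynomial.X : k[X]) ^ p}

variable (k p) in
/-- The class of the variable in `k[u]/(u^p)`. -/
def truncVar : TruncPoly k p := Ideal.Quotient.mk _ Polynomial.X

theorem truncVar_pow : truncVar k p ^ p = 0 := by
  rw [truncVar, ← map_pow]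
  exact Ideal.Quotient.eq_zero_iff_mem.2 (Ideal.mem_span_singleton_self _)

variable {M : Type*} [AddCommGroup M] [Module k M]

/-- The action of `k[u]/(u^p)` on `M` for which `u` acts via `x`. -/
def truncAct (x : Module.End k M) (hx : x ^ p = 0) : TruncPoly k p →ₐ[k] Module.End k M :=
  Ideal.Quotient.liftₐ _ (Polynomial.aeval x) (by
    intro f hf
    obtain ⟨g, rfl⟩ := Ideal.mem_span_singleton.1 hf
    simp [hx])

theorem truncAct_mk (x : Module.End k M) (hx : x ^ p = 0) (f : k[X]) :
    truncAct x hx (Ideal.Quotient.mk _ f) = Polynomial.aeval x f := rfl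

theorem truncAct_truncVar (x : Module.End k M) (hx : x ^ p = 0) :
    truncAct x hx (truncVar k p) = x := Polynomial.aeval_X _

theorem commute_truncAct {x y : Module.End k M} (hx : x ^ p = 0) (hxy : Commute y x)
    (s : TruncPoly k p) : Commute y (truncAct x hx s) := by
  obtain ⟨f, rfl⟩ := Ideal.Quotient.mk_surjective s
  rw [truncAct_mk]
  induction f using Polynomial.induction_on' with
  | add f g hf hg => rw [map_add]; exact hf.add_right hg
  | monomial n a =>
    rw [Polynomial.aeval_monomial]
    exact Commute.mul_right (Algebra.commutes a y).symm (hxy.pow_right n)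

end TruncatedAction

section TensorEvaluation

variable {k : Type*} [Field k] {S : Type*} [CommRing S] [Algebra k S] {M : Type*} [AddCommGroup M]
  [Module k M] (ρ : S →ₐ[k] Module.End k M)

/-- The map `S ⊗ M → M`, `s ⊗ m ↦ ρ(s) m`, for an action `ρ` of `S` on `M`. -/
def tensorEval : S ⊗[k] M →ₗ[k] M := TensorProduct.lift ρ.toLinearMap

theorem tensorEval_tmul (s : S) (m : M) : tensorEval ρ (s ⊗ₜ m) = ρ s m := rfl

theorem tensorEval_smul (s : S) (y : S ⊗[k] M) :
    tensorEval ρ (s • y) = ρ s (tensorEval ρ y) := by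
  induction y with
  | zero => simp
  | add y z hy hz => simp only [smul_add, map_add, hy, hz]
  | tmul t m => simp [TensorProduct.smul_tmul', tensorEval_tmul]

theorem tensorEval_baseChange {a : Module.End k M} (ha : ∀ s, Commute a (ρ s)) (y : S ⊗[k] M) :
    tensorEval ρ (a.baseChange S y) = a (tensorEval ρ y) := by
  induction y with
  | zero => simp
  | add y z hy hz => simp only [map_add, hy, hz]
  | tmul t m =>
    rw [LinearMap.baseChange_tmul, tensorEval_tmul, tensorEval_tmul, ← Module.End.mul_apply,
      ← Module.End.mul_apply, (ha t).eq]

end TensorEvaluation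

/-! ### Higman's condition under perturbation -/

theorem add_pow_of_commute {k : Type*} [Field k] {p : ℕ} (hp : p.Prime) [CharP k p] {E : Type*}
    [Ring E] [Algebra k E] {x y : E} (h : Commute x y) : (x + y) ^ p = x ^ p + y ^ p := by
  obtain ⟨r, hr⟩ := h.exists_add_pow_prime_eq hp
  have h0 : (p : E) = 0 := by rw [← map_natCast (algebraMap k E), CharP.cast_eq_zero, map_zero]
  rw [hr, h0]
  simp

/-- Adding a nilpotent multiple of any element does not affect Higman's condition: the same `h` has
trace `1` up to a nilpotent multiple of an element. -/
theorem HigmanSplit.add_smul {S : Type*} [CommRing S] {E : Type*} [Ring E] [Algebra S E] {p : ℕ}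
    {a b : E} {t : S} (ht : IsNilpotent t) (ha : HigmanSplit p a) (hab : (a + t • b) ^ p = 0) :
    HigmanSplit p (a + t • b) := by
  obtain ⟨h, hh⟩ := ha
  have hpow : ∀ n : ℕ, ∃ w, (a + t • b) ^ n = a ^ n + t • w := by
    intro n
    induction n with
    | zero => exact ⟨0, by simp⟩
    | succ n ih =>
      obtain ⟨w, hw⟩ := ih
      refine ⟨a ^ n * b + w * a + t • (w * b), ?_⟩
      rw [pow_succ, hw, pow_succ]
      simp only [add_mul, mul_add, smul_mul_assoc, mul_smul_comm, smul_add]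
      abel
  choose w hw using hpow
  refine HigmanSplit.of_isUnit (h := h) hab ?_
  have htr : relTrace p (a + t • b) h = 1 + t • ∑ i ∈ Finset.range p,
      (a ^ i * h * w (p - 1 - i) + w i * h * a ^ (p - 1 - i) +
        t • (w i * h * w (p - 1 - i))) := by
    rw [← hh, relTrace, relTrace, Finset.smul_sum, ← Finset.sum_add_distrib]
    refine Finset.sum_congr rfl fun i _ => ?_
    rw [hw, hw]
    simp only [add_mul, mul_add, smul_mul_assoc, mul_smul_comm, smul_add]
    abel
  rw [htr]
  refine IsNilpotent.isUnit_one_add ?_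
  obtain ⟨m, hm⟩ := ht
  exact ⟨m, by rw [smul_pow, hm, zero_smul]⟩

/-- Let `S` be a commutative algebra that acts on `M` and `t ∈ S` with `t^p = 0`, and let `c` be the
action of `t`. If `a` and `b` commute with each other and with `S`, `a^p = b^p = 0`, and `a`
satisfies Higman's condition, then so does `a + bc`.

On `S ⊗ M` the operator `y = a + tb` satisfies Higman's condition, as `t` is nilpotent.
With `x = a + bc` and `d = t - c` one has `y = x + bd`. If `x z = 0`, then
`y^(p-1) (b z) = b^p d^(p-1) z = 0`, so `b z = y v`, and `y (z - d v) = 0`, so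
`z - d v = y^(p-1) q`. The map `S ⊗ M → M` takes `t` to `c`, hence `d` to `0` and `y` to `x`, which
exhibits `z` as an element of `x^(p-1) M`. -/
theorem HigmanSplit.add_mul_action {k : Type*} [Field k] {p : ℕ} (hp : p.Prime) [CharP k p]
    {M : Type*} [AddCommGroup M] [Module k M] {S : Type*} [CommRing S] [Algebra k S]
    (ρ : S →ₐ[k] Module.End k M) {t : S} (ht : t ^ p = 0) {a b : Module.End k M}
    (hab : Commute a b) (haρ : ∀ s, Commute a (ρ s)) (hbρ : ∀ s, Commute b (ρ s))
    (hap : a ^ p = 0) (hbp : b ^ p = 0) (ha : HigmanSplit p a) :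
    HigmanSplit p (a + b * ρ t) := by
  set c := ρ t with hc
  have hac : Commute a c := haρ t
  have hbc : Commute b c := hbρ t
  have hcρ : ∀ s, Commute c (ρ s) := fun s => (Commute.all t s).map ρ
  have hx : (a + b * c) ^ p = 0 := by
    rw [add_pow_of_commute (k := k) hp (hab.mul_right hac), hap, hbc.mul_pow, hbp, zero_mul, add_zero]
  refine HigmanSplit.of_exact hp.ne_zero hx fun z hz => ?_
  let ι := Module.End.baseChangeHom k S M
  let y := ι a + t • ι b
  let d : Module.End S (S ⊗[k] M) := t • 1 + ι (-c)
  let ζ : S ⊗[k] M := 1 ⊗ₜ z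
  have hιb : ι b ^ p = 0 := by rw [← map_pow, hbp, map_zero]
  have hyp : y ^ p = 0 := by
    have h1 : Commute (ι a) (t • ι b) := (hab.map ι).smul_right t
    rw [add_pow_of_commute (k := k) (E := Module.End S (S ⊗[k] M)) hp h1,
      ← map_pow, hap, smul_pow, hιb, map_zero, smul_zero,
      add_zero]
  have hy : HigmanSplit p y := by
    refine HigmanSplit.add_smul ⟨p, ht⟩ ?_ hyp
    obtain ⟨h, hh⟩ := ha
    refine ⟨ι h, ?_⟩
    rw [← map_one ι, ← hh]
    simp [relTrace]
  have hyd : y = ι (a + b * c) + ι b * d := by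
    simp only [y, d]
    rw [mul_add, mul_smul_comm, mul_one, ← map_mul, add_left_comm, ← map_add, mul_neg,
      add_neg_cancel_right, add_comm]
  have hd : ∀ u : Module.End S (S ⊗[k] M), Commute u (ι (-c)) → Commute u d := fun u hu =>
    ((Commute.one_right u).smul_right t).add_right hu
  have hbd : Commute (ι b) d := hd _ (hbc.neg_right.map ι)
  have hxbd : Commute (ι (a + b * c)) (ι b * d) := by
    have h1 : Commute (a + b * c) b := hab.add_left ((Commute.refl b).mul_left hbc.symm)
    have h2 : Commute (a + b * c) c := hac.add_left (hbc.mul_left (Commute.refl c))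
    exact (h1.map ι).mul_right (hd _ (h2.neg_right.map ι))
  have hyb : Commute y (ι b) := ((hab.map ι).add_left ((Commute.refl _).smul_left t))
  have hdy : Commute d y :=
    (hd _ ((hac.neg_right.map ι).add_left ((hbc.neg_right.map ι).smul_left t))).symm
  have hxζ : ι (a + b * c) ζ = 0 := by
    change (1 : S) ⊗ₜ[k] (a + b * c) z = 0
    rw [hz, TensorProduct.tmul_zero]
  have hyζ : ∀ i : ℕ, (y ^ i) ζ = ((ι b * d) ^ i) ζ := by
    intro i
    induction i with
    | zero => rfl
    | succ i ih =>
      rw [pow_succ', Module.End.mul_apply, ih, hyd, LinearMap.add_apply, ← Module.End.mul_apply,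
        (hxbd.pow_right i).eq, Module.End.mul_apply, hxζ, map_zero, zero_add,
        ← Module.End.mul_apply, ← pow_succ']
  have hw : (y ^ (p - 1)) (ι b ζ) = 0 := by
    rw [← Module.End.mul_apply, (hyb.pow_left _).eq, Module.End.mul_apply, hyζ, hbd.mul_pow,
      Module.End.mul_apply, ← Module.End.mul_apply, ← pow_succ', Nat.sub_add_cancel hp.one_le, hιb,
      LinearMap.zero_apply]
  obtain ⟨v, hv⟩ := hy.exists_apply_eq hw
  have hk : y (ζ - d v) = 0 := by
    have h1 := hyζ 1
    rw [pow_one, pow_one] at h1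
    rw [map_sub, h1, hbd.eq, Module.End.mul_apply, ← Module.End.mul_apply y, ← hdy.eq,
      Module.End.mul_apply, hv, sub_self]
  obtain ⟨q, hq⟩ := hy.exists_pow_apply_eq hp.ne_zero hk
  let π := tensorEval ρ
  have hπy : ∀ u, π (y u) = (a + b * c) (π u) := by
    intro u
    change π (a.baseChange S u + t • b.baseChange S u) = _
    rw [map_add, tensorEval_smul, tensorEval_baseChange ρ haρ, tensorEval_baseChange ρ hbρ,
      ← hc, hbc.eq]
    rfl
  have hπpow : ∀ i u, π ((y ^ i) u) = ((a + b * c) ^ i) (π u) := by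
    intro i
    induction i with
    | zero => exact fun u => rfl
    | succ i ih =>
      intro u
      rw [pow_succ, Module.End.mul_apply, ih, hπy, pow_succ, Module.End.mul_apply]
  have hπd : π (d v) = 0 := by
    change π (t • v + (-c).baseChange S v) = 0
    rw [map_add, tensorEval_smul, tensorEval_baseChange ρ fun s => (hcρ s).neg_left, ← hc,
      LinearMap.neg_apply, add_neg_cancel]
  refine ⟨π q, ?_⟩
  rw [← hπpow, hq, map_sub, hπd, sub_zero]
  change ρ 1 z = z
  rw [map_one, Module.End.one_apply]

/-- For commuting `a, b, c` with zero `p`-th powers, if `M` is projective with `u` acting via `a`,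
then also with `u` acting via `a + bc`. -/
theorem HigmanSplit.add_mul_of_commute {k : Type*} [Field k] {p : ℕ} (hp : p.Prime) [CharP k p]
    {M : Type*} [AddCommGroup M] [Module k M] {a b c : Module.End k M}
    (hab : Commute a b) (hac : Commute a c) (hbc : Commute b c)
    (hap : a ^ p = 0) (hbp : b ^ p = 0) (hcp : c ^ p = 0) (ha : HigmanSplit p a) :
    HigmanSplit p (a + b * c) := by
  have h1 := HigmanSplit.add_mul_action hp (truncAct c hcp) truncVar_pow hab
    (commute_truncAct hcp hac) (commute_truncAct hcp hbc) hap hbp ha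
  rwa [truncAct_truncVar] at h1

/-- Exactness of projective modules over `k[u]/(u^p)`. -/
theorem exists_truncVar_pow_smul_eq {k : Type*} [Field k] {p : ℕ} (hp : p ≠ 0) {Q : Type*}
    [AddCommGroup Q] [Module (TruncPoly k p) Q] [Module.Projective (TruncPoly k p) Q] {z : Q}
    (hz : truncVar k p • z = 0) : ∃ y, truncVar k p ^ (p - 1) • y = z := by
  have hR : ∀ s : TruncPoly k p, truncVar k p * s = 0 → ∃ s', truncVar k p ^ (p - 1) * s' = s := by
    intro s hs
    obtain ⟨f, rfl⟩ := Ideal.Quotient.mk_surjective s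
    rw [truncVar, ← map_mul, Ideal.Quotient.eq_zero_iff_mem, Ideal.mem_span_singleton] at hs
    obtain ⟨g, hg⟩ := hs
    refine ⟨Ideal.Quotient.mk _ g, ?_⟩
    rw [truncVar, ← map_pow, ← map_mul]
    congr 1
    refine mul_left_cancel₀ (Polynomial.X_ne_zero (R := k)) ?_
    rw [hg, ← mul_assoc, ← pow_succ', Nat.sub_add_cancel (Nat.one_le_iff_ne_zero.2 hp)]
  obtain ⟨s, hs⟩ := Module.projective_def.1 (inferInstance : Module.Projective (TruncPoly k p) Q)
  have h1 : ∀ i, ∃ s', truncVar k p ^ (p - 1) * s' = s z i := fun i => hR _ (by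
    rw [← smul_eq_mul, ← Finsupp.smul_apply, ← map_smul, hz, map_zero, Finsupp.zero_apply])
  choose e he using h1
  refine ⟨∑ i ∈ (s z).support, e i • i, ?_⟩
  conv_rhs => rw [← hs z, Finsupp.linearCombination_apply, Finsupp.sum]
  rw [Finset.smul_sum]
  refine Finset.sum_congr rfl fun i _ => ?_
  rw [smul_smul, he, id_eq]

/-- If `∑ t^i h t^(p-1-i) = 1` on `M` and `t` generates `S`, then `m ↦ ∑ t^i ⊗ h(t^(p-1-i) m)` is an
`S`-linear section of `S ⊗ M → M`, so that `M` is projective. -/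
theorem projective_of_sum_smul_eq {k : Type*} [Field k] {p : ℕ} {S : Type*} [CommRing S]
    [Algebra k S] {M : Type*} [AddCommGroup M] [Module k M] [Module S M] [IsScalarTower k S M]
    {t : S} (ht : t ^ p = 0) (hS : Algebra.adjoin k {t} = ⊤) (h : Module.End k M)
    (hh : ∀ m : M, ∑ i ∈ Finset.range p, t ^ i • h (t ^ (p - 1 - i) • m) = m) :
    Module.Projective S M := by
  let T : M →ₗ[k] M := Algebra.lsmul k k M t
  have hT : ∀ (i : ℕ) (m : M), (T ^ i) m = t ^ i • m := fun i m => by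
    simp only [T, ← map_pow, Algebra.lsmul_coe]
  let σ : M →ₗ[k] S ⊗[k] M := ∑ i ∈ Finset.range p,
    TensorProduct.mk k S M (t ^ i) ∘ₗ h ∘ₗ (T ^ (p - 1 - i))
  have hσm : ∀ m, σ m = ∑ i ∈ Finset.range p, (t ^ i) ⊗ₜ[k] h (t ^ (p - 1 - i) • m) := by
    intro m
    simp only [σ, LinearMap.sum_apply, LinearMap.comp_apply, TensorProduct.mk_apply, hT]
  have hσt : ∀ m, σ (t • m) = t • σ m := by
    intro m
    let f : ℕ → S ⊗[k] M := fun i => (t ^ i) ⊗ₜ h (t ^ (p - i) • m)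
    have h1 : σ (t • m) = ∑ i ∈ Finset.range p, f i := by
      rw [hσm]
      refine Finset.sum_congr rfl fun i hi => ?_
      have hi := Finset.mem_range.1 hi
      rw [smul_smul, ← pow_succ, show p - 1 - i + 1 = p - i by omega]
    have h2 : t • σ m = ∑ i ∈ Finset.range p, f (i + 1) := by
      rw [hσm, Finset.smul_sum]
      refine Finset.sum_congr rfl fun i _ => ?_
      rw [TensorProduct.smul_tmul', smul_eq_mul, ← pow_succ',
        show p - 1 - i = p - (i + 1) by omega]
    rw [h1, h2, ← sub_eq_zero, ← Finset.sum_sub_distrib, ← neg_eq_zero, ← Finset.sum_neg_distrib]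
    simp only [neg_sub]
    rw [Finset.sum_range_sub]
    simp [f, ht]
  have hσ : ∀ (s : S) (m : M), σ (s • m) = s • σ m := by
    intro s
    have hs : s ∈ Algebra.adjoin k {t} := hS ▸ Algebra.mem_top
    induction hs using Algebra.adjoin_induction with
    | mem s hs => rw [Set.mem_singleton_iff.1 hs]; exact hσt
    | algebraMap a => exact fun m => by rw [algebraMap_smul, map_smul, algebraMap_smul]
    | add s s' _ _ hs hs' => exact fun m => by rw [add_smul, map_add, hs, hs', add_smul]
    | mul s s' _ _ hs hs' => exact fun m => by rw [mul_smul, hs, hs', mul_smul]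
  refine Module.Projective.of_split (M := S ⊗[k] M)
    { toFun := σ, map_add' := map_add σ, map_smul' := hσ }
    ((LinearMap.id : M →ₗ[k] M).liftBaseChange S) (LinearMap.ext fun m => ?_)
  change (LinearMap.id : M →ₗ[k] M).liftBaseChange S (σ m) = m
  rw [hσm, map_sum]
  simpa using hh m

/-- Higman's criterion for modules over `k[u]/(u^p)`, of any dimension. -/
theorem projectiveVia_iff_higmanSplit {k : Type*} [Field k] {p : ℕ} (hp : p ≠ 0) {M : Type*}
    [AddCommGroup M] [Module k M] (x : Module.End k M) (hx : x ^ p = 0) :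
    ProjectiveVia x hx ↔ HigmanSplit p x := by
  let := truncModule x hx
  have hsmul : ∀ (s : TruncPoly k p) (m : M), s • m = truncAct x hx s m := fun _ _ => rfl
  have hvar : ∀ (i : ℕ) (m : M), truncVar k p ^ i • m = (x ^ i) m := fun i m => by
    rw [hsmul, map_pow, truncAct_truncVar]
  constructor
  · intro h
    have : Module.Projective (TruncPoly k p) M := h
    refine HigmanSplit.of_exact hp hx fun z hz => ?_
    obtain ⟨y, hy⟩ := exists_truncVar_pow_smul_eq (k := k) hp (z := z)
      (by rw [← pow_one (truncVar k p), hvar, pow_one, hz])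
    exact ⟨y, by rw [← hvar, hy]⟩
  · rintro ⟨h, hh⟩
    have : IsScalarTower k (TruncPoly k p) M := IsScalarTower.of_algebraMap_smul fun a m => by
      rw [hsmul, AlgHom.commutes, Module.algebraMap_end_apply]
    have hgen : Algebra.adjoin k {truncVar k p} = ⊤ := by
      have h1 := congrArg (Subalgebra.map (Ideal.Quotient.mkₐ k
        (Ideal.span {(Polynomial.X : k[X]) ^ p}))) (Polynomial.adjoin_X (R := k))
      rw [AlgHom.map_adjoin, Set.image_singleton, Algebra.map_top] at h1
      exact h1.trans (AlgHom.range_eq_top _ |>.2 (Ideal.Quotient.mkₐ_surjective _ _))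
    refine projective_of_sum_smul_eq truncVar_pow hgen h fun m => ?_
    have h1 := LinearMap.congr_fun hh m
    rw [relTrace, LinearMap.sum_apply] at h1
    simp only [hvar]
    exact h1

/-! ### Commuting families of nilpotent elements -/

section NilpotentFamily

variable {k : Type*} [Field k] {D : Type*} [Ring D] [Algebra k D]

theorem commute_of_mem_adjoin {s : Set D} (hs : ∀ x ∈ s, ∀ y ∈ s, Commute x y) {x y : D}
    (hx : x ∈ NonUnitalAlgebra.adjoin k s) (hy : y ∈ NonUnitalAlgebra.adjoin k s) :
    Commute x y :=
  NonUnitalAlgebra.commute_of_mem_adjoin_of_forall_mem_commute hy fun b hb =>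
    (NonUnitalAlgebra.commute_of_mem_adjoin_of_forall_mem_commute hx fun a ha => hs b hb a ha).symm

variable {p : ℕ} [CharP k p]

theorem pow_eq_zero_of_mem_adjoin (hp : p.Prime) {s : Set D}
    (hs : ∀ x ∈ s, ∀ y ∈ s, Commute x y) (h0 : ∀ x ∈ s, x ^ p = 0) {x : D}
    (hx : x ∈ NonUnitalAlgebra.adjoin k s) : x ^ p = 0 := by
  induction hx using NonUnitalAlgebra.adjoin_induction with
  | mem x hx => exact h0 x hx
  | add x y hx hy hx0 hy0 =>
    rw [add_pow_of_commute (k := k) hp (commute_of_mem_adjoin hs hx hy), hx0, hy0, add_zero]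
  | zero => exact zero_pow hp.ne_zero
  | mul x y hx hy hx0 _ => rw [(commute_of_mem_adjoin hs hx hy).mul_pow, hx0, zero_mul]
  | smul c x _ hx0 => rw [smul_pow, hx0, smul_zero]

variable {M : Type*} [AddCommGroup M] [Module k M] (ρ : D →ₐ[k] Module.End k M)

/-- Let `𝔪` be the non-unital algebra generated by a commuting family of elements with zero `p`-th
powers. Whether `M` is projective with `u` acting via `y ∈ 𝔪` depends only on `y` modulo `𝔪²`. -/
theorem higmanSplit_add_iff (hp : p.Prime) {s : Set D}
    (hs : ∀ x ∈ s, ∀ y ∈ s, Commute x y) (h0 : ∀ x ∈ s, x ^ p = 0) {y d : D}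
    (hy : y ∈ NonUnitalAlgebra.adjoin k s)
    (hd : d ∈ (NonUnitalAlgebra.adjoin k s).toSubmodule * (NonUnitalAlgebra.adjoin k s).toSubmodule) :
    HigmanSplit p (ρ (y + d)) ↔ HigmanSplit p (ρ y) := by
  have hpow : ∀ x ∈ NonUnitalAlgebra.adjoin k s, ρ x ^ p = 0 := fun x hx => by
    rw [← map_pow, pow_eq_zero_of_mem_adjoin hp hs h0 hx, map_zero]
  have key : ∀ d ∈ (NonUnitalAlgebra.adjoin k s).toSubmodule *
      (NonUnitalAlgebra.adjoin k s).toSubmodule, d ∈ NonUnitalAlgebra.adjoin k s ∧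
      ∀ y ∈ NonUnitalAlgebra.adjoin k s, HigmanSplit p (ρ y) → HigmanSplit p (ρ (y + d)) := by
    intro d hd
    refine Submodule.mul_induction_on hd (fun b hb c hc => ?_) fun d d' hd hd' => ?_
    · refine ⟨mul_mem hb hc, fun y hy hsplit => ?_⟩
      rw [map_add, map_mul]
      exact hsplit.add_mul_of_commute hp ((commute_of_mem_adjoin hs hy hb).map ρ)
        ((commute_of_mem_adjoin hs hy hc).map ρ) ((commute_of_mem_adjoin hs hb hc).map ρ)
        (hpow y hy) (hpow b hb) (hpow c hc)
    · refine ⟨add_mem hd.1 hd'.1, fun y hy hsplit => ?_⟩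
      rw [← add_assoc]
      exact hd'.2 _ (add_mem hy hd.1) (hd.2 y hy hsplit)
  refine ⟨fun h => ?_, (key d hd).2 y hy⟩
  have h1 := (key (-d) (neg_mem hd)).2 _ (add_mem hy (key d hd).1) h
  rwa [add_neg_cancel_right] at h1

/-- `∏ G_i - 1` has coefficients in `𝔪`, and agrees with `∑ (G_i - 1)` modulo `𝔪²`, if each
`G_i - 1` has coefficients in `𝔪`. -/
theorem coeff_list_prod_mem (S : NonUnitalSubalgebra k D) (L : List (PowerSeries D))
    (hL : ∀ G ∈ L, ∀ n, PowerSeries.coeff n (G - 1) ∈ S) (n : ℕ) :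
    PowerSeries.coeff n (L.prod - 1) ∈ S ∧
      PowerSeries.coeff n (L.prod - 1 - (L.map fun G => G - 1).sum) ∈
        S.toSubmodule * S.toSubmodule := by
  induction L generalizing n with
  | nil => simp
  | cons G L ih =>
    have hG := hL G List.mem_cons_self
    have ih' := ih fun G hG => hL G (List.mem_cons_of_mem _ hG)
    have h2 : PowerSeries.coeff n ((G - 1) * (L.prod - 1)) ∈ S.toSubmodule * S.toSubmodule := by
      rw [PowerSeries.coeff_mul]
      exact Submodule.sum_mem _ fun q _ => Submodule.mul_mem_mul (hG _) (ih' _).1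
    have h1 : PowerSeries.coeff n ((G - 1) * (L.prod - 1)) ∈ S := by
      rw [PowerSeries.coeff_mul]
      exact sum_mem fun q _ => mul_mem (hG _) (ih' _).1
    rw [List.prod_cons, List.map_cons, List.sum_cons]
    constructor
    · rw [show G * L.prod - 1 = (G - 1) * (L.prod - 1) + (G - 1) + (L.prod - 1) by noncomm_ring,
        map_add, map_add]
      exact add_mem (add_mem h1 (hG n)) (ih' n).1
    · rw [show G * L.prod - 1 - (G - 1 + (L.map fun G => G - 1).sum) =
        (G - 1) * (L.prod - 1) + (L.prod - 1 - (L.map fun G => G - 1).sum) by noncomm_ring, map_add]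
      exact add_mem h2 (ih' n).2

/-- The coefficients in positive degree of a product of power series with constant term `1` and other
coefficients in `𝔪` are the sums of the coefficients of the factors, modulo `𝔪²`. -/
theorem exists_coeff_list_prod_eq (S : NonUnitalSubalgebra k D) {ι : Type*} (L : List ι)
    (G : ι → PowerSeries D) (h0 : ∀ i ∈ L, PowerSeries.coeff 0 (G i) = 1)
    (hG : ∀ i ∈ L, ∀ n, n ≠ 0 → PowerSeries.coeff n (G i) ∈ S) {n : ℕ} (hn : n ≠ 0) :
    ∃ d ∈ S.toSubmodule * S.toSubmodule, PowerSeries.coeff n (L.map G).prod =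
      (L.map fun i => PowerSeries.coeff n (G i)).sum + d := by
  have hL : ∀ g ∈ L.map G, ∀ m, PowerSeries.coeff m (g - 1) ∈ S := by
    intro g hg m
    obtain ⟨i, hi, rfl⟩ := List.mem_map.1 hg
    rw [map_sub, PowerSeries.coeff_one]
    split_ifs with hm
    · rw [hm, h0 i hi, sub_self]
      exact zero_mem S
    · rw [sub_zero]
      exact hG i hi m hm
  refine ⟨_, (coeff_list_prod_mem S (L.map G) hL n).2, ?_⟩
  have h1 : PowerSeries.coeff n ((L.map G).map fun g => g - 1).sum =
      (L.map fun i => PowerSeries.coeff n (G i)).sum := by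
    rw [map_list_sum, List.map_map, List.map_map]
    congr 2
    funext i
    rw [Function.comp_apply, Function.comp_apply, map_sub, PowerSeries.coeff_one, if_neg hn,
      sub_zero]
  rw [map_sub, h1, map_sub, PowerSeries.coeff_one, if_neg hn, sub_zero, add_sub_cancel]

end NilpotentFamily

/-! ### Divided powers in the distribution algebra of the additive group -/

section Quotients

variable {k : Type*} [Field k] {A : Type*} [CommRing A] [HopfAlgebra k A]

variable (k) in
/-- The inclusion of the closed subgroup scheme defined by a Hopf ideal `J`, as the homomorphism
`k[H] → k[H] / J` of bialgebras. -/
def quotientHom (J : Ideal A) [J.IsHopfIdeal k] : A →ₐc[k] A ⧸ J :=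
  BialgHom.ofAlgHom (Ideal.Quotient.mkₐ k J) (AlgHom.ext fun _ => rfl) (AlgHom.ext fun _ => rfl)

variable {B : Type*} [CommRing B] [HopfAlgebra k B]

theorem distMap_apply (φ : A →ₐc[k] B) (μ : Dist k B) (f : A) :
    (distMap φ μ).1 f = μ.1 (φ f) := rfl

theorem dist_mul_apply (μ ν : Dist k A) (f : A) :
    (μ * ν).1 f = LinearMap.mul' k k (TensorProduct.map μ.1.ofConv ν.1.ofConv
      (Coalgebra.comul (R := k) f)) := rfl

/-- The convolution product along a homomorphism of bialgebras. -/
theorem dist_mul_apply_map (q : A →ₐc[k] B) (μ ν : Dist k B) (f : A) :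
    (μ * ν).1 (q f) = LinearMap.mul' k k (TensorProduct.map (distMap q μ).1.ofConv
      (distMap q ν).1.ofConv (Coalgebra.comul (R := k) f)) := by
  rw [← distMap_apply, map_mul, dist_mul_apply]

theorem dist_ext_of_surjective {q : A →ₐc[k] B} (hq : Function.Surjective q) {μ ν : Dist k B}
    (h : ∀ f, μ.1 (q f) = ν.1 (q f)) : μ = ν := by
  refine Subtype.ext (WithConv.ext (LinearMap.ext fun x => ?_))
  obtain ⟨f, rfl⟩ := hq x
  exact h f

end Quotients

section DividedPowers

variable {k : Type*} [Field k] (p r : ℕ) [Fact p.Prime] [CharP k p]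

/-- Every linear form on `k[G_a(r)]` is a distribution. -/
theorem mem_dist_frobKer_polynomial (μ : WithConv (FrobKer k p r k[X] →ₗ[k] k)) :
    μ ∈ Dist k (FrobKer k p r k[X]) := by
  refine ⟨p ^ r, Nat.one_le_pow _ _ (Fact.out : p.Prime).pos, fun f hf => ?_⟩
  have h1 : augIdeal k (FrobKer k p r k[X]) ≤
      Ideal.span {Ideal.Quotient.mk (frobIdeal k p r k[X]) Polynomial.X} := by
    intro g hg
    obtain ⟨g, rfl⟩ := Ideal.Quotient.mk_surjective g
    obtain ⟨c, rfl⟩ := Polynomial.X_dvd_iff.2 ((counit_polynomial g).symm.trans hg)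
    exact Ideal.mem_span_singleton.2 ⟨_, map_mul _ _ _⟩
  have h2 : Ideal.Quotient.mk (frobIdeal k p r k[X]) Polynomial.X ^ p ^ r = 0 := by
    rw [← map_pow]
    exact Ideal.Quotient.eq_zero_iff_mem.2 (pow_mem_frobIdeal k p r k[X] counit_X)
  have h3 := Ideal.pow_right_mono h1 (p ^ r) hf
  rw [Ideal.span_singleton_pow, h2, Ideal.span_singleton_zero, Ideal.mem_bot] at h3
  rw [h3]
  exact map_zero μ.ofConv

/-- The divided power `v_n` of `d/dt`: the linear form on `k[G_a(r)]` that takes the coefficient of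
`t^n`. It is `0` for `n ≥ p^r`. -/
def divElt (n : ℕ) : Dist k (FrobKer k p r k[X]) :=
  ⟨WithConv.toConv (Submodule.liftQ ((frobIdeal k p r k[X]).restrictScalars k)
    (if n < p ^ r then Polynomial.lcoeff k n else 0) (by
      intro f hf
      have h1 := Ideal.mem_span_singleton.1 (frobIdeal_polynomial_le p r hf)
      split_ifs with hn
      · exact Polynomial.X_pow_dvd_iff.1 h1 _ hn
      · rfl)), mem_dist_frobKer_polynomial p r _⟩

theorem divElt_apply (n : ℕ) (f : k[X]) :
    (divElt p r n).1 (quotientHom k (frobIdeal k p r k[X]) f) =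
      if n < p ^ r then f.coeff n else 0 := by
  change (if n < p ^ r then Polynomial.lcoeff k n else 0) f = _
  split_ifs <;> rfl

theorem uElt_eq_divElt (j : ℕ) (hj : j < r) : uElt (k := k) p r j hj = divElt p r (p ^ j) := by
  refine dist_ext_of_surjective (q := quotientHom k (frobIdeal k p r k[X]))
    Ideal.Quotient.mk_surjective fun f => ?_
  rw [divElt_apply, if_pos (Nat.pow_lt_pow_right (Fact.out : p.Prime).one_lt hj)]
  rfl

theorem divElt_zero : divElt (k := k) p r 0 = 1 := by
  refine dist_ext_of_surjective (q := quotientHom k (frobIdeal k p r k[X]))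
    Ideal.Quotient.mk_surjective fun f => ?_
  rw [divElt_apply, if_pos (pow_pos (Fact.out : p.Prime).pos _), ← counit_polynomial]
  rfl

theorem comul_X_pow (m : ℕ) : Coalgebra.comul (R := k) ((Polynomial.X : k[X]) ^ m) =
    ∑ i ∈ Finset.range (m + 1), (m.choose i : k) •
      ((Polynomial.X ^ i : k[X]) ⊗ₜ[k] (Polynomial.X ^ (m - i) : k[X])) := by
  rw [← Bialgebra.comulAlgHom_apply, map_pow, Bialgebra.comulAlgHom_apply, comul_X, add_pow]
  refine Finset.sum_congr rfl fun i _ => ?_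
  rw [Algebra.TensorProduct.tmul_pow, Algebra.TensorProduct.tmul_pow,
    Algebra.TensorProduct.tmul_mul_tmul, one_pow, one_pow, one_mul, mul_one, mul_comm,
    ← nsmul_eq_mul, Nat.cast_smul_eq_nsmul]

/-- The product of divided powers, also when `a + b ≥ p^r`, in which case both sides are `0`. -/
theorem divElt_mul (a b : ℕ) : divElt (k := k) p r a * divElt p r b =
    ((a + b).choose a : k) • divElt p r (a + b) := by
  let q := quotientHom k (frobIdeal k p r k[X])
  refine dist_ext_of_surjective (q := q) Ideal.Quotient.mk_surjective fun f => ?_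
  let Φ : k[X] →ₗ[k] k := (distMap q (divElt p r a * divElt p r b)).1.ofConv
  let Ψ : k[X] →ₗ[k] k := (distMap q (((a + b).choose a : k) • divElt p r (a + b))).1.ofConv
  suffices h : Φ = Ψ from LinearMap.congr_fun h f
  -- Both forms are compared on the monomials `X^m`; for `m ≥ p^r` these vanish on `G_a(r)`.
  refine Polynomial.lhom_ext' fun m => LinearMap.ext_ring ?_
  change Φ (Polynomial.monomial m 1) = Ψ (Polynomial.monomial m 1)
  rw [Polynomial.monomial_one_right_eq_X_pow]
  rcases le_or_gt (p ^ r) m with hm | hm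
  · have h0 : q (Polynomial.X ^ m) = 0 :=
      Ideal.Quotient.eq_zero_iff_mem.2 (Ideal.mem_of_dvd _ (pow_dvd_pow _ hm)
        (pow_mem_frobIdeal k p r k[X] counit_X))
    change (divElt (k := k) p r a * divElt p r b).1.ofConv (q (Polynomial.X ^ m)) =
      (((a + b).choose a : k) • divElt (k := k) p r (a + b)).1.ofConv (q (Polynomial.X ^ m))
    rw [h0, map_zero, map_zero]
  · have h1 : Φ (Polynomial.X ^ m) = ∑ i ∈ Finset.range (m + 1), (m.choose i : k) *
        ((if i = a then 1 else 0) * (if m - i = b then 1 else 0)) := by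
      change (divElt (k := k) p r a * divElt p r b).1 (q (Polynomial.X ^ m)) = _
      rw [dist_mul_apply_map, comul_X_pow, map_sum, map_sum]
      refine Finset.sum_congr rfl fun i hi => ?_
      have hi := Finset.mem_range.1 hi
      have hv : ∀ c j, j ≤ m → (distMap q (divElt (k := k) p r c)).1.ofConv (Polynomial.X ^ j) =
          if j = c then 1 else 0 := by
        intro c j hj
        refine (divElt_apply p r c (Polynomial.X ^ j)).trans ?_
        rw [Polynomial.coeff_X_pow]
        split_ifs <;> first | rfl | omega
      rw [map_smul, map_smul, TensorProduct.map_tmul, LinearMap.mul'_apply, smul_eq_mul,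
        hv a i (by omega), hv b (m - i) (by omega)]
    have h2 : Ψ (Polynomial.X ^ m) = ((a + b).choose a : k) * if a + b = m then 1 else 0 := by
      change ((a + b).choose a : k) • (divElt p r (a + b)).1 (q (Polynomial.X ^ m)) = _
      rw [divElt_apply, Polynomial.coeff_X_pow, smul_eq_mul]
      split_ifs <;> first | rfl | omega
    rw [h1, h2]
    by_cases hab : a + b = m
    · rw [if_pos hab, Finset.sum_eq_single a]
      · rw [if_pos rfl, if_pos (by omega), hab, mul_one]
      · intro i _ hi
        rw [if_neg hi, zero_mul, mul_zero]
      · intro h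
        exact absurd (Finset.mem_range.2 (by omega)) h
    · rw [if_neg hab, mul_zero]
      refine Finset.sum_eq_zero fun i hi => ?_
      have hi := Finset.mem_range.1 hi
      split_ifs <;> first | omega | simp

/-- `v_n^p = 0` for `n > 0`, as the binomial coefficient `(pn choose n)` is divisible by `p`. -/
theorem divElt_pow {n : ℕ} (hn : n ≠ 0) : divElt (k := k) p r n ^ p = 0 := by
  have h1 : ∀ m : ℕ, ∃ c : k, divElt (k := k) p r n ^ m = c • divElt p r (m * n) := by
    intro m
    induction m with
    | zero => exact ⟨1, by rw [pow_zero, zero_mul, divElt_zero, one_smul]⟩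
    | succ m ih =>
      obtain ⟨c, hc⟩ := ih
      refine ⟨c * ((m * n + n).choose (m * n) : k), ?_⟩
      rw [pow_succ, hc, smul_mul_assoc, divElt_mul, smul_smul, add_mul, one_mul]
  obtain ⟨c, hc⟩ := h1 (p - 1)
  have hp := (Fact.out : p.Prime)
  have hdvd : p ∣ ((p - 1) * n + n).choose ((p - 1) * n) := by
    obtain ⟨n, rfl⟩ := Nat.exists_eq_succ_of_ne_zero hn
    have h2 : (p - 1) * (n + 1) + (n + 1) = p * (n + 1) := by
      rw [← Nat.succ_mul, Nat.succ_eq_add_one, Nat.sub_add_cancel hp.one_le]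
    rw [Nat.choose_symm_add, Nat.succ_eq_add_one, h2]
    have h3 : p * (n + 1) - 1 + 1 = p * (n + 1) :=
      Nat.sub_add_cancel (Nat.mul_pos hp.pos n.succ_pos)
    have h4 := Nat.add_one_mul_choose_eq (p * (n + 1) - 1) n
    rw [h3] at h4
    refine ⟨(p * (n + 1) - 1).choose n, Nat.eq_of_mul_eq_mul_right n.succ_pos ?_⟩
    rw [Nat.succ_eq_add_one, ← h4]
    ring
  rw [← pow_sub_one_mul hp.ne_zero, hc, smul_mul_assoc, divElt_mul,
    (CharP.cast_eq_zero_iff k p _).2 hdvd, zero_smul, smul_zero]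

end DividedPowers

/-! ### Distributions along exponential maps -/

section Points

variable {n : ℕ} {k : Type*} [Field k]

/-- If the points `g(s)` and `h(t)` commute, for independent variables `s` and `t`, then so do the
images of distributions under `g` and `h`. -/
theorem convolution_comm_of_commute {g h : GL (Fin n) k[X]}
    (hgh : Commute (glMap (Algebra.TensorProduct.includeLeft (R := k) (S := k) (B := k[X])) g)
      (glMap (Algebra.TensorProduct.includeRight (R := k) (A := k[X])) h))
    (σ τ : k[X] →ₗ[k] k) (f : GLRing n k) :
    LinearMap.mul' k k (TensorProduct.map (σ ∘ₗ (pointHom g).toLinearMap)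
        (τ ∘ₗ (pointHom h).toLinearMap) (Coalgebra.comul (R := k) f)) =
      LinearMap.mul' k k (TensorProduct.map (τ ∘ₗ (pointHom h).toLinearMap)
        (σ ∘ₗ (pointHom g).toLinearMap) (Coalgebra.comul (R := k) f)) := by
  let Ω : k[X] ⊗[k] k[X] →ₗ[k] k := LinearMap.mul' k k ∘ₗ TensorProduct.map σ τ
  let g' := glMap (Algebra.TensorProduct.includeLeft (R := k) (S := k) (B := k[X])) g
  let h' := glMap (Algebra.TensorProduct.includeRight (R := k) (A := k[X])) h
  have h1 : ∀ w : GLRing n k ⊗[k] GLRing n k,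
      LinearMap.mul' k k (TensorProduct.map (σ ∘ₗ (pointHom g).toLinearMap)
        (τ ∘ₗ (pointHom h).toLinearMap) w) =
      Ω (Algebra.TensorProduct.lift (pointHom g') (pointHom h') (fun _ _ => Commute.all _ _) w) := by
    intro w
    induction w with
    | zero => simp
    | add x y hx hy => simp only [map_add, hx, hy]
    | tmul x y =>
      rw [Algebra.TensorProduct.lift_tmul, ← comp_pointHom, ← comp_pointHom]
      simp [Ω]
  have h2 : ∀ w : GLRing n k ⊗[k] GLRing n k,
      LinearMap.mul' k k (TensorProduct.map (τ ∘ₗ (pointHom h).toLinearMap)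
        (σ ∘ₗ (pointHom g).toLinearMap) w) =
      Ω (Algebra.TensorProduct.lift (pointHom h') (pointHom g') (fun _ _ => Commute.all _ _) w) := by
    intro w
    induction w with
    | zero => simp
    | add x y hx hy => simp only [map_add, hx, hy]
    | tmul x y =>
      rw [Algebra.TensorProduct.lift_tmul, ← comp_pointHom, ← comp_pointHom]
      simp [Ω, mul_comm]
  have h3 : pointHom (k := k) (g' * h') f = pointHom (h' * g') f := by rw [hgh.eq]
  rw [pointHom_mul, pointHom_mul] at h3
  rw [h1, h2]
  exact congrArg Ω h3

variable {A : Type*} [CommRing A] [HopfAlgebra k A]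

/-- The power series `G` with coefficients in `Dist(H)`, for a homomorphism `q : H → GL_n`, is the
expansion of the point `g(t)` of `GL_n` modulo `t^N`: its `m`-th coefficient sends a function `f` to
the coefficient of `t^m` in `f(g(t))`. -/
def IsExpansion (q : GLRing n k →ₐc[k] A) (N : ℕ) (g : GL (Fin n) k[X])
    (G : PowerSeries (Dist k A)) : Prop :=
  ∀ m < N, ∀ f, (PowerSeries.coeff m G).1 (q f) = (pointHom (k := k) g f).coeff m

variable {q : GLRing n k →ₐc[k] A} {N : ℕ}

theorem IsExpansion.one : IsExpansion q N 1 1 := by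
  intro m _ f
  have h1 : pointHom (k := k) (1 : GL (Fin n) k[X]) f =
      Polynomial.C (Coalgebra.counit (R := k) f) := by
    rw [← map_one (glMap (Algebra.ofId k k[X])), ← comp_pointHom]
    rfl
  rw [h1, Polynomial.coeff_C, PowerSeries.coeff_one]
  split_ifs
  · exact CoalgHomClass.counit_comp_apply q f
  · rfl

theorem IsExpansion.mul {g h : GL (Fin n) k[X]} {G H : PowerSeries (Dist k A)}
    (hg : IsExpansion q N g G) (hh : IsExpansion q N h H) : IsExpansion q N (g * h) (G * H) := by
  intro m hm f
  let γ : ℕ → GLRing n k →ₗ[k] k := fun i => Polynomial.lcoeff k i ∘ₗ (pointHom g).toLinearMap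
  let η : ℕ → GLRing n k →ₗ[k] k := fun i => Polynomial.lcoeff k i ∘ₗ (pointHom h).toLinearMap
  have h1 : ∀ w : GLRing n k ⊗[k] GLRing n k,
      (Algebra.TensorProduct.lift (pointHom (k := k) g) (pointHom h)
        (fun _ _ => Commute.all _ _) w).coeff m =
      ∑ ij ∈ Finset.HasAntidiagonal.antidiagonal m,
        LinearMap.mul' k k (TensorProduct.map (γ ij.1) (η ij.2) w) := by
    intro w
    induction w with
    | zero => simp
    | add x y hx hy => simp only [map_add, Polynomial.coeff_add, hx, hy, Finset.sum_add_distrib]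
    | tmul x y =>
      rw [Algebra.TensorProduct.lift_tmul, Polynomial.coeff_mul]
      rfl
  have h2 : ∀ (s : Finset (ℕ × ℕ)) (μ : ℕ × ℕ → Dist k A) (x : A),
      (∑ i ∈ s, μ i).1 x = ∑ i ∈ s, (μ i).1 x := by
    intro s μ x
    induction s using Finset.cons_induction with
    | empty => rfl
    | cons a s ha ih => rw [Finset.sum_cons, Finset.sum_cons, ← ih]; rfl
  rw [pointHom_mul, AlgHom.comp_apply, Bialgebra.comulAlgHom_apply, h1, PowerSeries.coeff_mul, h2]
  refine Finset.sum_congr rfl fun ij hij => ?_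
  have hij := Finset.HasAntidiagonal.mem_antidiagonal.1 hij
  have hγ : (distMap q (PowerSeries.coeff ij.1 G)).1.ofConv = γ ij.1 :=
    LinearMap.ext fun x => hg ij.1 (by omega) x
  have hη : (distMap q (PowerSeries.coeff ij.2 H)).1.ofConv = η ij.2 :=
    LinearMap.ext fun x => hh ij.2 (by omega) x
  rw [dist_mul_apply_map, hγ, hη]

theorem IsExpansion.list_prod {ι : Type*} {g : ι → GL (Fin n) k[X]} {G : ι → PowerSeries (Dist k A)}
    (L : List ι) (h : ∀ i ∈ L, IsExpansion q N (g i) (G i)) :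
    IsExpansion q N (L.map g).prod (L.map G).prod := by
  induction L with
  | nil => exact IsExpansion.one
  | cons i L ih =>
    rw [List.map_cons, List.map_cons, List.prod_cons, List.prod_cons]
    exact (h i List.mem_cons_self).mul (ih fun j hj => h j (List.mem_cons_of_mem _ hj))

end Points

section Exponential

variable {n : ℕ} {k : Type*} [Field k] (p r : ℕ) [Fact p.Prime] [CharP k p]
  (I : Ideal (GLRing n k)) [I.IsHopfIdeal k]

/-- The inclusion `G_(r) → GL_n`. -/
def frobKerHom : GLRing n k →ₐc[k] FrobKer k p r (GLRing n k ⧸ I) :=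
  (quotientHom k (frobIdeal k p r (GLRing n k ⧸ I))).comp (quotientHom k I)

theorem frobKerHom_surjective : Function.Surjective (frobKerHom p r I) :=
  Ideal.Quotient.mk_surjective.comp Ideal.Quotient.mk_surjective

variable {I}

theorem distMap_divElt_apply {g : GL (Fin n) k[X]} (φ : (GLRing n k ⧸ I) →ₐc[k] k[X])
    (hφ : ∀ f, φ (Ideal.Quotient.mk I f) = pointHom g f) (m : ℕ) (f : GLRing n k) :
    (distMap (frobRestrict p r φ) (divElt p r m)).1 (frobKerHom p r I f) =
      if m < p ^ r then (pointHom (k := k) g f).coeff m else 0 := by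
  rw [← hφ, ← divElt_apply]
  rfl

variable {p} {hI : IsExponentialType p I}

theorem expHom_mk {x : Matrix (Fin n) (Fin n) k} (hx : x ∈ nilCone p I) (f : GLRing n k) :
    expHom hI hx (Ideal.Quotient.mk I f) = pointHom (expPoint p x hx.2 Polynomial.X) f := rfl

theorem expTupleHom_mk {β : Fin r → Matrix (Fin n) (Fin n) k} (hβ : β ∈ commTuples p I r)
    (f : GLRing n k) : expTupleHom hI hβ (Ideal.Quotient.mk I f) =
      pointHom (expTuplePoint p β (fun i => (hβ.1 i).2) Polynomial.X) f := rfl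

variable (hI)

/-- The image of `v_m` under `exp_x`. -/
def expDiv {x : Matrix (Fin n) (Fin n) k} (hx : x ∈ nilCone p I) (m : ℕ) :
    Dist k (FrobKer k p r (GLRing n k ⧸ I)) :=
  distMap (frobRestrict p r (expHom hI hx)) (divElt p r m)

theorem expDiv_zero {x : Matrix (Fin n) (Fin n) k} (hx : x ∈ nilCone p I) :
    expDiv r hI hx 0 = 1 := by
  rw [expDiv, divElt_zero, map_one]

theorem expDiv_pow {x : Matrix (Fin n) (Fin n) k} (hx : x ∈ nilCone p I) {m : ℕ} (hm : m ≠ 0) :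
    expDiv r hI hx m ^ p = 0 := by
  rw [expDiv, ← map_pow, divElt_pow p r hm, map_zero]

theorem commute_expDiv {x y : Matrix (Fin n) (Fin n) k} (hx : x ∈ nilCone p I)
    (hy : y ∈ nilCone p I) (hxy : Commute x y) (a b : ℕ) :
    Commute (expDiv r hI hx a) (expDiv r hI hy b) := by
  refine dist_ext_of_surjective (frobKerHom_surjective p r I) fun f => ?_
  have h1 : ∀ {z : Matrix (Fin n) (Fin n) k} (hz : z ∈ nilCone p I) (c : ℕ),
      (distMap (frobKerHom p r I) (expDiv r hI hz c)).1.ofConv =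
        (if c < p ^ r then Polynomial.lcoeff k c else 0) ∘ₗ
          (pointHom (expPoint p z hz.2 Polynomial.X)).toLinearMap := by
    intro z hz c
    refine LinearMap.ext fun f => (distMap_divElt_apply p r _ (expHom_mk hz) c f).trans ?_
    split_ifs <;> rfl
  rw [dist_mul_apply_map, dist_mul_apply_map, h1, h1]
  refine convolution_comm_of_commute ?_ _ _ f
  rw [glMap_expPoint, glMap_expPoint]
  exact expPoint_commute p hx.2 hy.2 hxy _ _

/-- The expansion of `exp_x(t^(p^i))`. -/
def expSeries {x : Matrix (Fin n) (Fin n) k} (hx : x ∈ nilCone p I) (i : ℕ) :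
    PowerSeries (Dist k (FrobKer k p r (GLRing n k ⧸ I))) :=
  PowerSeries.mk fun m => if p ^ i ∣ m then expDiv r hI hx (m / p ^ i) else 0

theorem coeff_expSeries {x : Matrix (Fin n) (Fin n) k} (hx : x ∈ nilCone p I) (i m : ℕ) :
    PowerSeries.coeff m (expSeries r hI hx i) =
      if p ^ i ∣ m then expDiv r hI hx (m / p ^ i) else 0 :=
  PowerSeries.coeff_mk _ _

theorem isExpansion_expSeries {x : Matrix (Fin n) (Fin n) k} (hx : x ∈ nilCone p I) (i : ℕ) :
    IsExpansion (frobKerHom p r I) (p ^ r) (expPoint p x hx.2 ((Polynomial.X : k[X]) ^ p ^ i))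
      (expSeries r hI hx i) := by
  intro m hm f
  have hpos : 0 < p ^ i := pow_pos (Fact.out : p.Prime).pos i
  have h1 : pointHom (expPoint p x hx.2 ((Polynomial.X : k[X]) ^ p ^ i)) f =
      Polynomial.expand k (p ^ i) (pointHom (expPoint p x hx.2 Polynomial.X) f) := by
    rw [← AlgHom.comp_apply, comp_pointHom, glMap_expPoint, Polynomial.expand_X]
  rw [h1, Polynomial.coeff_expand hpos, coeff_expSeries]
  split_ifs
  · rw [expDiv, distMap_divElt_apply p r _ (expHom_mk hx),
      if_pos ((Nat.div_le_self _ _).trans_lt hm)]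
  · rfl

/-- `d exp_β(v_m)` is the coefficient of `t^m` in `∏ exp_{β_i}(t^(p^i))`. -/
theorem distMap_expTupleHom_divElt {β : Fin r → Matrix (Fin n) (Fin n) k}
    (hβ : β ∈ commTuples p I r) {m : ℕ} (hm : m < p ^ r) :
    distMap (frobRestrict p r (expTupleHom hI hβ)) (divElt p r m) =
      PowerSeries.coeff m
        ((List.finRange r).map fun i => expSeries r hI (hβ.1 i) (i : ℕ)).prod := by
  refine dist_ext_of_surjective (frobKerHom_surjective p r I) fun f => ?_
  rw [distMap_divElt_apply p r _ (expTupleHom_mk r hβ), if_pos hm, expTuplePoint,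
    List.ofFn_eq_map]
  exact (IsExpansion.list_prod _ (fun i _ => isExpansion_expSeries r hI (hβ.1 i) i) m hm f).symm

section Family

variable {ι : Type*} {β : ι → Matrix (Fin n) (Fin n) k} (hβ : ∀ i, β i ∈ nilCone p I)

/-- The images of the `v_m` with `m > 0` under the homomorphisms `exp_{β_i}`. -/
def expGenerators : Set (Dist k (FrobKer k p r (GLRing n k ⧸ I))) :=
  {e | ∃ i m, m ≠ 0 ∧ expDiv r hI (hβ i) m = e}

theorem expDiv_mem_adjoin (i : ι) {m : ℕ} (hm : m ≠ 0) :
    expDiv r hI (hβ i) m ∈ NonUnitalAlgebra.adjoin k (expGenerators r hI hβ) :=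
  NonUnitalAlgebra.subset_adjoin k ⟨i, m, hm, rfl⟩

theorem commute_of_mem_expGenerators (hc : ∀ i j, Commute (β i) (β j)) :
    ∀ e ∈ expGenerators r hI hβ, ∀ e' ∈ expGenerators r hI hβ, Commute e e' := by
  rintro _ ⟨i, a, _, rfl⟩ _ ⟨j, b, _, rfl⟩
  exact commute_expDiv r hI (hβ i) (hβ j) (hc i j) a b

theorem pow_eq_zero_of_mem_expGenerators : ∀ e ∈ expGenerators r hI hβ, e ^ p = 0 := by
  rintro _ ⟨i, a, ha, rfl⟩
  exact expDiv_pow r hI (hβ i) ha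

theorem coeff_zero_expSeries (i : ι) (j : ℕ) :
    PowerSeries.coeff 0 (expSeries r hI (hβ i) j) = 1 := by
  rw [coeff_expSeries, if_pos (dvd_zero _), Nat.zero_div, expDiv_zero]

theorem coeff_expSeries_mem (i : ι) (j : ℕ) {m : ℕ} (hm : m ≠ 0) :
    PowerSeries.coeff m (expSeries r hI (hβ i) j) ∈
      NonUnitalAlgebra.adjoin k (expGenerators r hI hβ) := by
  rw [coeff_expSeries]
  split_ifs with hd
  · exact expDiv_mem_adjoin r hI hβ i (Nat.div_pos (Nat.le_of_dvd (Nat.pos_of_ne_zero hm) hd)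
      (pow_pos (Fact.out : p.Prime).pos _)).ne'
  · exact zero_mem _

end Family

/-- `d exp_β(u_{r-1}) ≡ ∑ d exp_{β_i}(u_{r-1-i})` modulo `𝔪²`, where `𝔪` is the non-unital algebra
generated by the `d exp_{β_i}(v_m)` with `m > 0`. -/
theorem exists_distMap_expTupleHom_eq (hr : 0 < r) {β : Fin r → Matrix (Fin n) (Fin n) k}
    (hβ : β ∈ commTuples p I r) (hN : ∀ i, β i ∈ nilCone p I) :
    ∃ d ∈ (NonUnitalAlgebra.adjoin k (expGenerators r hI hN)).toSubmodule *
        (NonUnitalAlgebra.adjoin k (expGenerators r hI hN)).toSubmodule,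
      distMap (frobRestrict p r (expTupleHom hI hβ)) (divElt p r (p ^ (r - 1))) =
        ∑ i : Fin r, expDiv r hI (hN i) (p ^ (r - 1 - (i : ℕ))) + d := by
  have hp : p.Prime := Fact.out
  obtain ⟨d, hd, h⟩ := exists_coeff_list_prod_eq
    (NonUnitalAlgebra.adjoin k (expGenerators r hI hN)) (List.finRange r)
    (fun i => expSeries r hI (hN i) (i : ℕ)) (fun i _ => coeff_zero_expSeries r hI hN i i)
    (fun i _ m hm => coeff_expSeries_mem r hI hN i i hm) (pow_pos hp.pos (r - 1)).ne'
  refine ⟨d, hd, ?_⟩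
  rw [distMap_expTupleHom_divElt r hI hβ (Nat.pow_lt_pow_right hp.one_lt (by omega)), h,
    ← Fin.sum_univ_def]
  congr 1
  refine Finset.sum_congr rfl fun i _ => ?_
  have hi : (i : ℕ) ≤ r - 1 := by omega
  rw [coeff_expSeries, if_pos (pow_dvd_pow p hi), Nat.pow_div hi hp.pos]

end Exponential

end FrobeniusKernels

end

theorem mainTheorem4 {k : Type*} [Field k] [IsAlgClosed k] (p : ℕ) [Fact p.Prime] [CharP k p]
    (n : ℕ) (I : Ideal (FrobeniusKernels.GLRing n k)) [I.IsHopfIdeal k]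
    (hI : FrobeniusKernels.IsExponentialType p I)
    (r : ℕ) (hr : 0 < r) (β : Fin r → Matrix (Fin n) (Fin n) k)
    (hβ : β ∈ FrobeniusKernels.commTuples p I r)
    (M : Type*) [AddCommGroup M] [Module k M]
    [FrobeniusKernels.GroupModule k
      (FrobeniusKernels.FrobKer k p r (FrobeniusKernels.GLRing n k ⧸ I)) M] :
    ∃ (hx : FrobeniusKernels.distAction M
          (FrobeniusKernels.distMap
            (FrobeniusKernels.frobRestrict p r (FrobeniusKernels.expTupleHom hI hβ))
            (FrobeniusKernels.uElt p r (r - 1) (by omega))) ^ p = 0)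
      (hy : FrobeniusKernels.distAction M
          (∑ i : Fin r, FrobeniusKernels.distMap
            (FrobeniusKernels.frobRestrict p r (FrobeniusKernels.expHom hI (hβ.1 i)))
            (FrobeniusKernels.uElt p r (r - 1 - (i : ℕ)) (by omega))) ^ p = 0),
      FrobeniusKernels.ProjectiveVia _ hx ↔ FrobeniusKernels.ProjectiveVia _ hy := by
  have hp : p.Prime := Fact.out
  have hN : ∀ i, β i ∈ FrobeniusKernels.nilCone p I := hβ.1
  have hcomm := FrobeniusKernels.commute_of_mem_expGenerators r hI hN
    fun i j => sub_eq_zero.1 (hβ.2 i j)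
  have hnil := FrobeniusKernels.pow_eq_zero_of_mem_expGenerators r hI hN
  have hy : (∑ i : Fin r, FrobeniusKernels.distMap
      (FrobeniusKernels.frobRestrict p r (FrobeniusKernels.expHom hI (hβ.1 i)))
      (FrobeniusKernels.uElt p r (r - 1 - (i : ℕ)) (by omega))) =
      ∑ i : Fin r, FrobeniusKernels.expDiv r hI (hN i) (p ^ (r - 1 - (i : ℕ))) :=
    Finset.sum_congr rfl fun i _ => by
      rw [FrobeniusKernels.uElt_eq_divElt, FrobeniusKernels.expDiv]
  have hymem : ∑ i : Fin r, FrobeniusKernels.expDiv r hI (hN i) (p ^ (r - 1 - (i : ℕ))) ∈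
      NonUnitalAlgebra.adjoin k (FrobeniusKernels.expGenerators r hI hN) :=
    sum_mem fun i _ => FrobeniusKernels.expDiv_mem_adjoin r hI hN i (pow_pos hp.pos _).ne'
  obtain ⟨d, hd, hx⟩ := FrobeniusKernels.exists_distMap_expTupleHom_eq r hI hr hβ hN
  have hy0 := FrobeniusKernels.pow_eq_zero_of_mem_adjoin hp hcomm hnil hymem
  have hiff := FrobeniusKernels.higmanSplit_add_iff (FrobeniusKernels.distAction M) hp hcomm hnil
    hymem hd
  rw [← FrobeniusKernels.uElt_eq_divElt p r (r - 1) (by omega)] at hx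
  refine ⟨?_, ?_, ?_⟩
  · rw [← map_pow, ← map_pow, FrobeniusKernels.uElt_eq_divElt,
      FrobeniusKernels.divElt_pow p r (pow_pos hp.pos _).ne', map_zero, map_zero]
  · rw [← map_pow, hy, hy0, map_zero]
  · rw [← hx, ← hy] at hiff
    exact (FrobeniusKernels.projectiveVia_iff_higmanSplit hp.ne_zero _ _).trans
      (hiff.trans (FrobeniusKernels.projectiveVia_iff_higmanSplit hp.ne_zero _ _).symm)
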